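/- **Theorem.** Let $n$ be an odd positive integer, $q=2^n$, and let $\mathrm{Tr}$ be the absolute trace $\mathbb{F}_q\to\mathbb{F}_2\subseteq\mathbb{F}_q$. Let $\mathbb{K}_n^{td}=(\mathbb{F}_q,+,\circ)$ be the symplectic presemifield with multiplication $$x\circ y := xy+\mathrm{Tr}(x)\sqrt{y}+\mathrm{Tr}(x^2y).$$ Let $\Pi(\mathbb{K}_n^{td})$ be the projective plane of order $q$ whose points are the pairs $(x,y)\in\mathbb{F}_q^2$ and the points at infinity $(a)$, $a\in\mathbb{F}_q\cup\{\infty\}$, and whose lines are $$l_{a,b}=\{(x,y): y=x\circ a+b\}\cup\{(a)\},\qquad l_a=\{(a,y): y\in\mathbb{F}_q\}\cup\{(\infty)\}\qquad (a,b\in\mathbb{F}_q),$$ $$l_\infty=\{(a): a\in\mathbb{F}_q\cup\{\infty\}\}.$$ For a positive integer $d$ put $$\mathcal{O}_d:=\{(y^{2^d}+y,\,y): y\in\mathbb{F}_q\}\cup\{(0),(1)\}.$$ A hyperoval of $\Pi(\mathbb{K}_n^{td})$ is a set of $q+2$ points, no three of which are collinear, and two hyperovals are equivalent if some collineation of the plane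 maps one onto the other. Let $d$ and $e$ be positive integers with $\gcd(n,d)=\gcd(n,e)=1$. Then $\mathcal{O}_d$ and $\mathcal{O}_e$ are hyperovals of $\Pi(\mathbb{K}_n^{td})$, and they are equivalent if and only if $d\equiv\pm e\pmod n$. -/

import Mathlib

/-- Points of the plane coordinatised by a presemifield with underlying set `F`:
the affine points `(x, y)`, the points `(a)` at infinity, and the point `(∞)`. -/
inductive PlanePoint (F : Type*) where
  | affine (x y : F)
  | slope (a : F)
  | infty

/-- Lines of the plane: `line a b` is `l_{a,b}`, `vertical a` is `l_a`, and `atInfty` is `l_∞`. -/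
inductive PlaneLine (F : Type*) where
  | line (a b : F)
  | vertical (a : F)
  | atInfty

namespace SemifieldPlane

variable {F : Type*}

/-- Incidence in the plane coordinatised by `(F, +, mul)`: the points of `l_{a,b}` are the affine
points with `y = mul x a + b`, and `(a)`; those of `l_a` are all `(a, y)`, and `(∞)`; those of
`l_∞` are all the points `(a)`, and `(∞)`. -/
def Incident [Add F] (mul : F → F → F) : PlanePoint F → PlaneLine F → Prop
  | .affine x y, .line a b => y = mul x a + b
  | .affine x _, .vertical a => x = a
  | .affine _ _, .atInfty => False
  | .slope c, .line a _ => c = a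
  | .slope _, .vertical _ => False
  | .slope _, .atInfty => True
  | .infty, .line _ _ => False
  | .infty, .vertical _ => True
  | .infty, .atInfty => True

/-- A collineation: a permutation of the points that, together with a permutation of the lines,
preserves incidence in both directions. -/
def IsCollineation [Add F] (mul : F → F → F) (φ : Equiv.Perm (PlanePoint F)) : Prop :=
  ∃ ψ : Equiv.Perm (PlaneLine F), ∀ P l, Incident mul (φ P) (ψ l) ↔ Incident mul P l

/-- Two sets of points are equivalent if some collineation maps the first onto the second. -/
def Equivalent [Add F] (mul : F → F → F) (O₁ O₂ : Set (PlanePoint F)) : Prop :=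
  ∃ φ : Equiv.Perm (PlanePoint F), IsCollineation mul φ ∧ φ '' O₁ = O₂

/-- A hyperoval: `q + 2` points, no three of which are collinear, where `q` is the order of the
plane, which is the cardinality of `F`. -/
def IsHyperoval [Add F] (mul : F → F → F) (O : Set (PlanePoint F)) : Prop :=
  O.ncard = Nat.card F + 2 ∧
    ∀ P ∈ O, ∀ Q ∈ O, ∀ R ∈ O, P ≠ Q → P ≠ R → Q ≠ R →
      ¬ ∃ l, Incident mul P l ∧ Incident mul Q l ∧ Incident mul R l

end SemifieldPlane

noncomputable section

/-- The absolute trace of a finite field of characteristic `2`, with its values in the prime field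
regarded as elements of `F`. -/
def absTrace {F : Type*} [Field F] [CharP F 2] (x : F) : F :=
  letI := ZMod.algebra F 2
  algebraMap (ZMod 2) F (Algebra.trace (ZMod 2) F x)

/-- The multiplication `x ∘ y = x y + Tr(x) √y + Tr(x² y)` of the symplectic presemifield
`K_n^{td}`. The square root is the inverse of the bijection `z ↦ z²`. -/
def symplecticMul {F : Type*} [Field F] [Finite F] [CharP F 2] (x y : F) : F :=
  x * y + absTrace x * (frobeniusEquiv F 2).symm y + absTrace (x ^ 2 * y)

end

/-- The set `O_d` of all `(y^(2^d) + y, y)` together with `(0)` and `(1)`. -/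
def ovalSet (F : Type*) [Field F] (d : ℕ) : Set (PlanePoint F) :=
  {P | ∃ y : F, P = .affine (y ^ (2 ^ d) + y) y} ∪ {.slope 0, .slope 1}

/-!
Write `O_d` for `ovalSet F d`, and `R_a x = x ∘ a`, `L_x a = x ∘ a`.

`O_d` is a hyperoval (`isHyperoval_ovalSet`) because `y ↦ y + (y ^ 2 ^ d + y) ∘ a` has a kernel of
order at most two: elements of the kernel satisfy `(y ^ 2 ^ d + y) a = y + ε` with `ε` in the prime
field, and `y ↦ y ^ (2 ^ d - 1)` is injective on nonzero elements. The shear `(x, y) ↦ (x, y + x)`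
interchanges the slopes `0` and `1` and carries `O_d` to `O_e` when `d ≡ -e` modulo `n`
(`equivalent_ovalSet_of_modEq_neg`).

For the converse only `n ≥ 5` matters, as for `n = 1` and `n = 3` the congruence always holds.
First, every collineation fixes the line at infinity and the point `(∞)`
(`IsCollineationPair.fixes_flag`). A collineation that fixes the line at infinity and moves `(∞)`
permutes a spread by an additive map (`map_add_of_spread`), and in suitable coordinates the set of
all `R_a⁻¹`, with `0` adjoined, turns out to be closed under addition
(`IsCollineationPair.inverseAddClosed`); trace computations refute this. By duality, which replaces
`∘` by its opposite, a collineation that fixes `(∞)` and moves the line at infinity makes the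
`L_x⁻¹` closed under addition, which is refuted likewise. If a collineation moves the line at
infinity to `m`, then the group of translations, conjugated by it, fixes `m` pointwise and is
transitive off `m`, and so it contains a collineation of one of these two excluded types.

A collineation mapping `O_d` to `O_e` is therefore, up to a translation, an additive map which fixes
`(∞)` and preserves or interchanges the slopes `0` and `1`. As `x ∘ 1 = x`, it is described by a
single additive bijection `f` with `f (x ∘ s) = f x ∘ k s`, and preservation of the hyperovals says
that `f` conjugates `x ↦ x ^ 2 ^ d` to `x ↦ x ^ 2 ^ e` or to its inverse. Such an `f` commutes with
the Frobenius automorphism (`modEq_of_autotopism`), whence `d ≡ ±e`.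
-/

/-! ### The absolute trace of a finite field of characteristic two -/

section Trace

theorem finrank_eq_of_natCard_eq_two_pow {F : Type*} [Field F] [Finite F] [Algebra (ZMod 2) F]
    {n : ℕ} (hF : Nat.card F = 2 ^ n) : Module.finrank (ZMod 2) F = n := by
  have h := Module.natCard_eq_pow_finrank (K := ZMod 2) (V := F)
  rw [hF, Nat.card_zmod] at h
  exact (Nat.pow_right_injective le_rfl h).symm

variable {F : Type*} [Field F] [CharP F 2]

theorem absTrace_add (x y : F) : absTrace (x + y) = absTrace x + absTrace y := by
  simp [absTrace]

theorem absTrace_zero : absTrace (0 : F) = 0 := by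
  simp [absTrace]

theorem absTrace_eq_zero_or_one (x : F) : absTrace x = 0 ∨ absTrace x = 1 := by
  let := ZMod.algebra F 2
  have h : ∀ t : ZMod 2, t = 0 ∨ t = 1 := by decide
  rcases h (Algebra.trace (ZMod 2) F x) with h | h
  · left; simp only [absTrace]; rw [h, map_zero]
  · right; simp only [absTrace]; rw [h, map_one]

variable [Finite F]

theorem absTrace_sq (x : F) : absTrace (x ^ 2) = absTrace x := by
  let := ZMod.algebra F 2
  simp only [absTrace]
  congr 1
  exact Algebra.trace_eq_of_algEquiv (FiniteField.frobeniusAlgEquiv (ZMod 2) F 2) x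

theorem absTrace_two_pow (x : F) (d : ℕ) : absTrace (x ^ 2 ^ d) = absTrace x := by
  induction d with
  | zero => simp
  | succ k ih => rw [pow_succ, pow_mul, absTrace_sq, ih]

theorem absTrace_one {n : ℕ} (hn : Odd n) (hF : Nat.card F = 2 ^ n) : absTrace (1 : F) = 1 := by
  let := ZMod.algebra F 2
  have hr := finrank_eq_of_natCard_eq_two_pow hF
  have h1 : Algebra.trace (ZMod 2) F 1 = 1 := by
    have h := Algebra.trace_algebraMap (S := F) (1 : ZMod 2)
    rw [map_one, hr] at h
    rw [h, nsmul_one]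
    exact (ZMod.natCast_eq_one_iff_odd).2 hn
  simp only [absTrace]
  rw [h1, map_one]

theorem absTrace_absTrace {n : ℕ} (hn : Odd n) (hF : Nat.card F = 2 ^ n) (x : F) :
    absTrace (absTrace x) = absTrace x := by
  rcases absTrace_eq_zero_or_one x with h | h <;> rw [h]
  · exact absTrace_zero
  · exact absTrace_one hn hF

/-- The trace form is nondegenerate. -/
theorem exists_absTrace_mul_eq_one {x : F} (hx : x ≠ 0) : ∃ v, absTrace (x * v) = 1 := by
  let := ZMod.algebra F 2
  by_contra! h
  refine hx ((traceForm_nondegenerate (ZMod 2) F).1 x fun v => ?_)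
  rw [Algebra.traceForm_apply]
  refine (algebraMap (ZMod 2) F).injective ?_
  rw [map_zero]
  exact (absTrace_eq_zero_or_one (x * v)).resolve_right (h v)

/-- Distinct nonzero elements are separated by the trace form. -/
theorem exists_absTrace_mul_eq_one_and_zero {x y : F} (hx : x ≠ 0) (hxy : x ≠ y) :
    ∃ v, absTrace (x * v) = 1 ∧ absTrace (y * v) = 0 := by
  by_contra! h
  have hker : ∀ v, absTrace (y * v) = 0 → absTrace (x * v) = 0 := fun v hv =>
    (absTrace_eq_zero_or_one (x * v)).resolve_right fun h1 => h v h1 hv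
  obtain ⟨v, hv⟩ := exists_absTrace_mul_eq_one (show x + y ≠ 0 by
    rwa [Ne, CharTwo.add_eq_zero])
  obtain ⟨w, hw⟩ := exists_absTrace_mul_eq_one hx
  have hyv : absTrace (y * v) = 1 := by
    refine (absTrace_eq_zero_or_one _).resolve_left fun h0 => ?_
    rw [add_mul, absTrace_add, h0, hker v h0, add_zero] at hv
    exact zero_ne_one hv
  have hxv : absTrace (x * v) = 0 := by
    rw [add_mul, absTrace_add, hyv] at hv
    linear_combination hv
  have hyw : absTrace (y * w) = 1 :=
    (absTrace_eq_zero_or_one _).resolve_left (h w hw)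
  have h0 : absTrace (y * (v + w)) = 0 := by
    rw [mul_add, absTrace_add, hyv, hyw, CharTwo.add_self_eq_zero]
  have h1 := hker _ h0
  rw [mul_add, absTrace_add, hxv, hw, zero_add] at h1
  exact one_ne_zero h1

/-- Fewer than `log₂ |F|` additive functionals with values in `{0, 1}` have a common nonzero
zero. -/
theorem exists_ne_zero_forall_eq_zero {k : ℕ} (p : Fin k → F → F)
    (hadd : ∀ i x y, p i (x + y) = p i x + p i y) (h01 : ∀ i x, p i x = 0 ∨ p i x = 1)
    (hk : 2 ^ k < Nat.card F) : ∃ x, x ≠ 0 ∧ ∀ i, p i x = 0 := by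
  classical
  have := Fintype.ofFinite F
  rw [Nat.card_eq_fintype_card] at hk
  obtain ⟨x, y, hxy, he⟩ := Fintype.exists_ne_map_eq_of_card_lt
    (fun (x : F) (i : Fin k) => decide (p i x = 0)) (by simpa using hk)
  refine ⟨x + y, by rwa [Ne, CharTwo.add_eq_zero], fun i => ?_⟩
  have hi := congrFun he i
  simp only [decide_eq_decide] at hi
  rw [hadd]
  rcases h01 i x with hx | hx
  · rw [hx, hi.1 hx, add_zero]
  · have hy : p i y = 1 := (h01 i y).resolve_left fun hy => by
      rw [hi.2 hy] at hx; exact zero_ne_one hx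
    rw [hx, hy, CharTwo.add_self_eq_zero]

end Trace

/-! ### Powers of the Frobenius automorphism -/

section Frobenius

variable {F : Type*} [Field F]

section

variable [Finite F]

theorem pow_two_pow_eq_self {n : ℕ} (hF : Nat.card F = 2 ^ n) (x : F) : x ^ 2 ^ n = x := by
  have := Fintype.ofFinite F
  rw [← hF, Nat.card_eq_fintype_card, FiniteField.pow_card]

theorem pow_two_pow_mul_eq_self {n : ℕ} (hF : Nat.card F = 2 ^ n) (m : ℕ) (x : F) :
    x ^ 2 ^ (n * m) = x := by
  induction m with
  | zero => simp
  | succ k ih => rw [mul_add, mul_one, pow_add, pow_mul, ih, pow_two_pow_eq_self hF]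

theorem pow_two_pow_eq_of_modEq {n d e : ℕ} (hF : Nat.card F = 2 ^ n)
    (h : (d : ℤ) ≡ e [ZMOD n]) (x : F) : x ^ 2 ^ d = x ^ 2 ^ e := by
  wlog hde : d ≤ e generalizing d e
  · exact (this h.symm (not_le.1 hde).le).symm
  obtain ⟨k, rfl⟩ := Nat.exists_eq_add_of_le hde
  rw [Int.modEq_iff_dvd] at h
  have hk : n ∣ k := by
    have : (n : ℤ) ∣ k := by simpa using h
    exact_mod_cast this
  obtain ⟨c, rfl⟩ := hk
  rw [add_comm, pow_add, pow_mul, pow_two_pow_mul_eq_self hF]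

end

variable [CharP F 2]

theorem two_pow_add (d : ℕ) (x y : F) : (x + y) ^ 2 ^ d = x ^ 2 ^ d + y ^ 2 ^ d :=
  add_pow_char_pow x y 2 d

theorem pow_two_pow_injective (d : ℕ) : Function.Injective fun x : F => x ^ 2 ^ d := by
  intro x y h
  have h1 : (x + y) ^ 2 ^ d = 0 := by
    rw [two_pow_add]
    exact (CharTwo.add_eq_zero).2 h
  exact (CharTwo.add_eq_zero).1 (pow_eq_zero_iff (by positivity) |>.1 h1)

variable [Finite F]

/-- The fixed field of `x ↦ x ^ 2 ^ d` is the prime field when `d` is prime to the degree. -/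
theorem eq_zero_or_one_of_pow_two_pow_eq {n d : ℕ} (hF : Nat.card F = 2 ^ n)
    (hnd : Nat.gcd n d = 1) {x : F} (hx : x ^ 2 ^ d = x) : x = 0 ∨ x = 1 := by
  have hn : Function.IsPeriodicPt (frobenius F 2) n x := by
    rw [Function.IsPeriodicPt, Function.IsFixedPt, iterate_frobenius, pow_two_pow_eq_self hF]
  have hd : Function.IsPeriodicPt (frobenius F 2) d x := by
    rw [Function.IsPeriodicPt, Function.IsFixedPt, iterate_frobenius, hx]
  have h1 := hn.gcd hd
  rw [hnd, Function.IsPeriodicPt, Function.IsFixedPt, iterate_frobenius, pow_one] at h1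
  have h2 : x * (x - 1) = 0 := by linear_combination h1
  rcases mul_eq_zero.1 h2 with h | h
  · exact Or.inl h
  · exact Or.inr (sub_eq_zero.1 h)

theorem modEq_of_forall_pow_two_pow_eq {n d e : ℕ} (hF : Nat.card F = 2 ^ n)
    (h : ∀ x : F, x ^ 2 ^ d = x ^ 2 ^ e) : (d : ℤ) ≡ e [ZMOD n] := by
  wlog hde : d ≤ e generalizing d e
  · exact (this (fun x => (h x).symm) (not_le.1 hde).le).symm
  obtain ⟨k, rfl⟩ := Nat.exists_eq_add_of_le hde
  have hk : ∀ x : F, x ^ 2 ^ k = x := fun x => by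
    refine pow_two_pow_injective d ?_
    simp only
    rw [← pow_mul, ← pow_add, add_comm k d, ← h]
  let := ZMod.algebra F 2
  have hr := finrank_eq_of_natCard_eq_two_pow hF
  have ho := FiniteField.orderOf_frobeniusAlgHom (ZMod 2) F
  have hd : n ∣ k := by
    rw [← hr, ← ho]
    refine orderOf_dvd_of_pow_eq_one ?_
    ext x
    rw [AlgHom.coe_pow, FiniteField.coe_frobeniusAlgHom, pow_iterate]
    simpa using hk x
  obtain ⟨c, rfl⟩ := hd
  rw [Int.modEq_iff_dvd]
  exact ⟨c, by push_cast; ring⟩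

/-- An additive form of Hilbert's Theorem 90: the kernel of the trace is the image of
`y ↦ y ^ 2 ^ d + y`, since both are subgroups of index two. -/
theorem exists_eq_of_absTrace_eq_zero {n d : ℕ} (hn : Odd n) (hF : Nat.card F = 2 ^ n)
    (hnd : Nat.gcd n d = 1) {x : F} (hx : absTrace x = 0) : ∃ y, x = y ^ 2 ^ d + y := by
  let T : F →+ F := ⟨⟨absTrace, absTrace_zero⟩, absTrace_add⟩
  let φ : F →+ F := ⟨⟨fun y => y ^ 2 ^ d + y, by simp⟩, fun x y => by simp only [two_pow_add]; ring⟩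
  have hle : φ.range ≤ T.ker := by
    rintro _ ⟨y, rfl⟩
    change absTrace (y ^ 2 ^ d + y) = 0
    rw [absTrace_add, absTrace_two_pow, CharTwo.add_self_eq_zero]
  have hpair : Nat.card ({0, 1} : Set F) = 2 := by
    rw [Nat.card_coe_set_eq, Set.ncard_pair zero_ne_one]
  have hker : Nat.card φ.ker = 2 := by
    rw [← hpair]
    congr 1
    have : (φ.ker : Set F) = {0, 1} := by
      ext y
      simp only [SetLike.mem_coe, AddMonoidHom.mem_ker, Set.mem_insert_iff,
        Set.mem_singleton_iff]
      change y ^ 2 ^ d + y = 0 ↔ _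
      rw [CharTwo.add_eq_zero]
      refine ⟨eq_zero_or_one_of_pow_two_pow_eq hF hnd, ?_⟩
      rintro (rfl | rfl)
      · simp
      · simp
    rw [← this]; rfl
  have hran : Nat.card T.range = 2 := by
    rw [← hpair]
    have : (T.range : Set F) = {0, 1} := by
      ext y
      simp only [SetLike.mem_coe, AddMonoidHom.mem_range, Set.mem_insert_iff,
        Set.mem_singleton_iff]
      constructor
      · rintro ⟨z, rfl⟩
        exact absTrace_eq_zero_or_one z
      · rintro (rfl | rfl)
        · exact ⟨0, absTrace_zero⟩
        · exact ⟨1, absTrace_one hn hF⟩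
    rw [← this]; rfl
  have h1 := φ.ker.card_mul_index
  have h2 := T.ker.card_mul_index
  rw [AddSubgroup.index_ker, hker] at h1
  rw [AddSubgroup.index_ker, hran] at h2
  have heq : φ.range = T.ker :=
    AddSubgroup.eq_of_le_of_card_ge hle (by omega)
  have hx' : x ∈ T.ker := hx
  rw [← heq] at hx'
  obtain ⟨y, hy⟩ := hx'
  exact ⟨y, hy.symm⟩

end Frobenius

/-! ### Presemifield multiplications -/

namespace SemifieldPlane

/-- The multiplication of a presemifield: biadditive and without zero divisors. -/
structure IsPresemifieldMul {F : Type*} [AddCommGroup F] (mul : F → F → F) : Prop where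
  add_left : ∀ x y z, mul (x + y) z = mul x z + mul y z
  add_right : ∀ x y z, mul x (y + z) = mul x y + mul x z
  eq_zero_or_eq_zero : ∀ x y, mul x y = 0 → x = 0 ∨ y = 0

namespace IsPresemifieldMul

variable {F : Type*} [AddCommGroup F] {mul : F → F → F}

protected theorem flip (h : IsPresemifieldMul mul) : IsPresemifieldMul (flip mul) :=
  ⟨fun x y z => h.add_right z x y, fun x y z => h.add_left y z x,
    fun x y hxy => (h.eq_zero_or_eq_zero y x hxy).symm⟩

theorem mul_zero (h : IsPresemifieldMul mul) (x : F) : mul x 0 = 0 := by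
  have := h.add_right x 0 0
  rw [add_zero] at this
  exact left_eq_add.1 this

theorem zero_mul (h : IsPresemifieldMul mul) (x : F) : mul 0 x = 0 :=
  h.flip.mul_zero x

theorem mul_neg (h : IsPresemifieldMul mul) (x y : F) : mul x (-y) = -mul x y := by
  rw [eq_neg_iff_add_eq_zero, ← h.add_right, neg_add_cancel, h.mul_zero]

theorem neg_mul (h : IsPresemifieldMul mul) (x y : F) : mul (-x) y = -mul x y :=
  h.flip.mul_neg y x

theorem mul_sub (h : IsPresemifieldMul mul) (x y z : F) :
    mul x (y - z) = mul x y - mul x z := by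
  rw [sub_eq_add_neg, h.add_right, h.mul_neg, sub_eq_add_neg]

theorem sub_mul (h : IsPresemifieldMul mul) (x y z : F) :
    mul (x - y) z = mul x z - mul y z :=
  h.flip.mul_sub z x y

theorem mul_left_injective (h : IsPresemifieldMul mul) {a : F} (ha : a ≠ 0) :
    Function.Injective fun x => mul x a := by
  intro x y hxy
  have : mul (x - y) a = 0 := by rw [h.sub_mul]; exact sub_eq_zero.2 hxy
  exact sub_eq_zero.1 ((h.eq_zero_or_eq_zero _ _ this).resolve_right ha)

theorem mul_right_injective (h : IsPresemifieldMul mul) {x : F} (hx : x ≠ 0) :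
    Function.Injective fun a => mul x a :=
  h.flip.mul_left_injective hx

theorem exists_mul_eq [Finite F] (h : IsPresemifieldMul mul) {x : F} (hx : x ≠ 0) (y : F) :
    ∃ a, mul x a = y :=
  Finite.injective_iff_surjective.1 (h.mul_right_injective hx) y

end IsPresemifieldMul

/-! ### Collineations -/

section Collineation

variable {F : Type*} [AddCommGroup F] {mul : F → F → F}

/-- The permutation `φ` of the points and the permutation `ψ` of the lines form a collineation. -/
def IsCollineationPair (mul : F → F → F) (φ : Equiv.Perm (PlanePoint F))
    (ψ : Equiv.Perm (PlaneLine F)) : Prop :=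
  ∀ P l, Incident mul (φ P) (ψ l) ↔ Incident mul P l

theorem IsCollineationPair.symm {φ : Equiv.Perm (PlanePoint F)} {ψ : Equiv.Perm (PlaneLine F)}
    (h : IsCollineationPair mul φ ψ) : IsCollineationPair mul φ.symm ψ.symm := fun P l => by
  rw [← h (φ.symm P), φ.apply_symm_apply, ψ.apply_symm_apply]

theorem IsCollineationPair.trans {φ φ' : Equiv.Perm (PlanePoint F)}
    {ψ ψ' : Equiv.Perm (PlaneLine F)} (h : IsCollineationPair mul φ ψ)
    (h' : IsCollineationPair mul φ' ψ') :
    IsCollineationPair mul (φ.trans φ') (ψ.trans ψ') := fun _ _ =>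
  (h' _ _).trans (h _ _)

/-- The translation `(x, y) ↦ (x + u, y + v)`. -/
def translation (u v : F) : Equiv.Perm (PlanePoint F) where
  toFun
    | .affine x y => .affine (x + u) (y + v)
    | .slope a => .slope a
    | .infty => .infty
  invFun
    | .affine x y => .affine (x - u) (y - v)
    | .slope a => .slope a
    | .infty => .infty
  left_inv P := by cases P <;> simp
  right_inv P := by cases P <;> simp

/-- The action of a translation on the lines. -/
def translationLine (mul : F → F → F) (u v : F) : Equiv.Perm (PlaneLine F) where
  toFun
    | .line a b => .line a (b + v - mul u a)
    | .vertical a => .vertical (a + u)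
    | .atInfty => .atInfty
  invFun
    | .line a b => .line a (b - v + mul u a)
    | .vertical a => .vertical (a - u)
    | .atInfty => .atInfty
  left_inv l := by cases l <;> simp; abel
  right_inv l := by cases l <;> simp; abel

theorem isCollineationPair_translation (h : IsPresemifieldMul mul) (u v : F) :
    IsCollineationPair mul (translation u v) (translationLine mul u v) := by
  rintro (⟨x, y⟩ | c | _) (⟨a, b⟩ | a | _) <;>
    simp only [translation, translationLine, Incident, Equiv.coe_fn_mk, add_left_inj]
  rw [h.add_left, ← sub_eq_zero, ← sub_eq_zero (a := y)]
  refine Eq.congr ?_ rfl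
  abel

/-- The shear `(x, y) ↦ (x, y + x ∘ c)`. -/
def shear (mul : F → F → F) (c : F) : Equiv.Perm (PlanePoint F) where
  toFun
    | .affine x y => .affine x (y + mul x c)
    | .slope a => .slope (a + c)
    | .infty => .infty
  invFun
    | .affine x y => .affine x (y - mul x c)
    | .slope a => .slope (a - c)
    | .infty => .infty
  left_inv P := by cases P <;> simp
  right_inv P := by cases P <;> simp

theorem isCollineation_shear (h : IsPresemifieldMul mul) (c : F) :
    IsCollineation mul (shear mul c) := by
  refine ⟨⟨fun l => match l with
      | .line a b => .line (a + c) b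
      | .vertical a => .vertical a
      | .atInfty => .atInfty, fun l => match l with
      | .line a b => .line (a - c) b
      | .vertical a => .vertical a
      | .atInfty => .atInfty, fun l => by cases l <;> simp, fun l => by cases l <;> simp⟩, ?_⟩
  rintro (⟨x, y⟩ | s | _) (⟨a, b⟩ | a | _) <;>
    simp only [shear, Incident, Equiv.coe_fn_mk, add_left_inj]
  rw [h.add_right, add_right_comm, add_left_inj]

/-- The points of the plane of `mul` as the lines of the plane of the opposite multiplication. The
signs make incidence correspond to reversed incidence in every characteristic. -/
def dual : PlanePoint F ≃ PlaneLine F where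
  toFun
    | .affine x y => .line x (-y)
    | .slope a => .vertical a
    | .infty => .atInfty
  invFun
    | .line a b => .affine a (-b)
    | .vertical a => .slope a
    | .atInfty => .infty
  left_inv P := by cases P <;> simp
  right_inv l := by cases l <;> simp

theorem incident_flip_dual (P : PlanePoint F) (l : PlaneLine F) :
    Incident (flip mul) (dual.symm l) (dual P) ↔ Incident mul P l := by
  rcases P with (⟨x, y⟩ | s | _) <;> rcases l with (⟨a, b⟩ | a | _) <;>
    simp only [dual, Incident, Equiv.coe_fn_mk, Equiv.coe_fn_symm_mk, flip, eq_comm]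
  rw [add_comm, ← sub_eq_zero, ← sub_eq_zero (a := y), ← neg_eq_zero (a := y - _)]
  refine Eq.congr ?_ rfl
  abel

theorem IsCollineationPair.dual {φ : Equiv.Perm (PlanePoint F)} {ψ : Equiv.Perm (PlaneLine F)}
    (h : IsCollineationPair mul φ ψ) :
    IsCollineationPair (flip mul) ((dual.trans ψ).trans dual.symm)
      ((dual.symm.trans φ).trans dual) := fun P l => by
  have h1 := h (SemifieldPlane.dual.symm l) (SemifieldPlane.dual P)
  rw [← incident_flip_dual, ← incident_flip_dual (SemifieldPlane.dual.symm l)] at h1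
  simpa using h1

end Collineation

end SemifieldPlane

/-! ### Collineations fixing the line at infinity -/

/-- Let subgroups `S i` with pairwise trivial intersection cover `V`. A map that carries differences
in `S i` to differences in `S (κ i)` is additive if it fixes `0`: the sum of two vectors from
different subgroups is the fourth vertex of a parallelogram, and a sum inside one subgroup is
reached by way of a vector outside of it. -/
theorem map_add_of_spread {V ι : Type*} [AddCommGroup V] {S : ι → AddSubgroup V}
    (hcover : ∀ v, ∃ i, v ∈ S i) (hdisj : ∀ i j, i ≠ j → ∀ v, v ∈ S i → v ∈ S j → v = 0)
    (hproper : ∀ i, ∃ v, v ∉ S i) {A : V → V} {κ : ι → ι} (hκ : Function.Injective κ)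
    (hA : ∀ p q i, p - q ∈ S i → A p - A q ∈ S (κ i)) (h0 : A 0 = 0) (v w : V) :
    A (v + w) = A v + A w := by
  have hS : ∀ v i, v ∈ S i → A v ∈ S (κ i) := fun v i hv => by
    simpa [h0] using hA v 0 i (by simpa using hv)
  have key : ∀ v w i j, i ≠ j → v ∈ S i → w ∈ S j → A (v + w) = A v + A w := by
    intro v w i j hij hv hw
    have h1 := hA (v + w) w i (by simpa using hv)
    have h2 := hA (v + w) v j (by simpa using hw)
    have h3 := (S (κ i)).sub_mem h1 (hS v i hv)
    have h4 := (S (κ j)).sub_mem h2 (hS w j hw)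
    rw [sub_right_comm] at h4
    have h5 := hdisj _ _ (hκ.ne hij) _ h3 h4
    rw [sub_sub, sub_eq_zero] at h5
    rw [h5, add_comm]
  have key' : ∀ v w i, v ∈ S i → w ∉ S i → A (v + w) = A v + A w := by
    intro v w i hv hw
    obtain ⟨j, hj⟩ := hcover w
    exact key v w i j (fun h => hw (h ▸ hj)) hv hj
  obtain ⟨i, hi⟩ := hcover v
  by_cases hw : w ∈ S i
  · obtain ⟨u, hu⟩ := hproper i
    have hwu : w + u ∉ S i := fun h => hu (by simpa using (S i).sub_mem h hw)
    have h1 := key' (v + w) u i ((S i).add_mem hi hw) hu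
    have h2 := key' v (w + u) i hi hwu
    rw [key' w u i hw hu, ← add_assoc, h1, ← add_assoc] at h2
    exact add_right_cancel h2
  · exact key' v w i hi hw

namespace SemifieldPlane

variable {F : Type*} [AddCommGroup F] {mul : F → F → F}

/-- The points at infinity, indexed by the slopes, with `none` for `(∞)`. -/
def infinitePoint : Option F → PlanePoint F
  | none => .infty
  | some a => .slope a

/-- The members of the spread: the affine points of the lines through the origin, indexed by
their points at infinity. -/
def spread (h : IsPresemifieldMul mul) : Option F → AddSubgroup (F × F)
  | none =>
    { carrier := {v | v.1 = 0}
      zero_mem' := rfl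
      add_mem' := fun {a b} ha hb => by
        rw [Set.mem_ofPred_eq] at *
        rw [Prod.fst_add, ha, hb, add_zero]
      neg_mem' := fun {a} ha => by
        rw [Set.mem_ofPred_eq] at *
        rw [Prod.fst_neg, ha, neg_zero] }
  | some s =>
    { carrier := {v | v.2 = mul v.1 s}
      zero_mem' := (h.zero_mul s).symm
      add_mem' := fun {a b} ha hb => by
        rw [Set.mem_ofPred_eq] at *
        rw [Prod.fst_add, Prod.snd_add, h.add_left, ha, hb]
      neg_mem' := fun {a} ha => by
        rw [Set.mem_ofPred_eq] at *
        rw [Prod.fst_neg, Prod.snd_neg, h.neg_mul, ha] }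

theorem mem_spread_some (h : IsPresemifieldMul mul) {x y s : F} :
    (x, y) ∈ spread h (some s) ↔ y = mul x s := Iff.rfl

theorem exists_mem_spread [Finite F] (h : IsPresemifieldMul mul) (v : F × F) :
    ∃ i, v ∈ spread h i := by
  by_cases hv : v.1 = 0
  · exact ⟨none, hv⟩
  · obtain ⟨a, ha⟩ := h.exists_mul_eq hv v.2
    exact ⟨some a, ha.symm⟩

theorem eq_zero_of_mem_spread (h : IsPresemifieldMul mul) (i j : Option F) (hij : i ≠ j)
    (v : F × F) (hi : v ∈ spread h i) (hj : v ∈ spread h j) : v = 0 := by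
  have hx : ∀ s, v.1 = 0 → v ∈ spread h (some s) → v = 0 := fun s h0 hs => by
    refine Prod.ext h0 ?_
    change v.2 = mul v.1 s at hs
    rw [hs, h0, h.zero_mul, Prod.snd_zero]
  rcases i with _ | a <;> rcases j with _ | b
  · exact absurd rfl hij
  · exact hx b hi hj
  · exact hx a hj hi
  · change v.2 = mul v.1 a at hi
    change v.2 = mul v.1 b at hj
    refine hx a (by_contra fun h0 => hij ?_) hi
    rw [h.mul_right_injective h0 (hi.symm.trans hj)]

/-- Two affine points differ by an element of a spread member if and only if they lie on a line
through the corresponding point at infinity. -/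
theorem sub_mem_spread_iff (h : IsPresemifieldMul mul) (v w : F × F) (i : Option F) :
    v - w ∈ spread h i ↔ ∃ l, Incident mul (.affine v.1 v.2) l ∧
      Incident mul (.affine w.1 w.2) l ∧ Incident mul (infinitePoint i) l := by
  rcases i with _ | a
  · constructor
    · intro hv
      exact ⟨.vertical v.1, rfl, (sub_eq_zero.1 hv).symm, trivial⟩
    · rintro ⟨l | l | _, h1, h2, h3⟩
      · exact h3.elim
      · exact sub_eq_zero.2 (h1.trans h2.symm)
      · exact h1.elim
  · constructor
    · intro hv
      refine ⟨.line a (v.2 - mul v.1 a), (add_sub_cancel _ _).symm, ?_, rfl⟩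
      change v.2 - w.2 = mul (v.1 - w.1) a at hv
      change w.2 = mul w.1 a + (v.2 - mul v.1 a)
      rw [h.sub_mul] at hv
      rw [← sub_eq_zero] at hv ⊢
      rw [← neg_eq_zero, ← hv]
      abel
    · rintro ⟨⟨c, b⟩ | c | _, h1, h2, h3⟩
      · change a = c at h3
        subst h3
        change v.2 - w.2 = mul (v.1 - w.1) a
        change v.2 = _ at h1
        change w.2 = _ at h2
        rw [h1, h2, h.sub_mul, add_sub_add_right_eq_sub]
      · exact h3.elim
      · exact h1.elim

theorem incident_atInfty_iff {P : PlanePoint F} :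
    Incident mul P .atInfty ↔ ∃ i, P = infinitePoint i := by
  rcases P with ⟨x, y⟩ | a | _
  · refine ⟨fun h => h.elim, ?_⟩
    rintro ⟨_ | i, hi⟩ <;> cases hi
  · exact ⟨fun _ => ⟨some a, rfl⟩, fun _ => trivial⟩
  · exact ⟨fun _ => ⟨none, rfl⟩, fun _ => trivial⟩

theorem infinitePoint_injective {F : Type*} : Function.Injective (infinitePoint (F := F)) := by
  rintro (_ | a) (_ | b) hab <;> cases hab <;> rfl

/-- A collineation that fixes the line at infinity acts on the affine points as an additive
permutation of the spread followed by a translation. -/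
theorem IsCollineationPair.exists_addMonoidHom [Finite F] [Nontrivial F]
    (h : IsPresemifieldMul mul) {φ : Equiv.Perm (PlanePoint F)} {ψ : Equiv.Perm (PlaneLine F)}
    (hφ : IsCollineationPair mul φ ψ) (hψ : ψ .atInfty = .atInfty) :
    ∃ (B : F × F →+ F × F) (v₀ : F × F) (κ : Equiv.Perm (Option F)),
      (∀ v : F × F, φ (.affine v.1 v.2) = .affine (B v + v₀).1 (B v + v₀).2) ∧
      (∀ i, φ (infinitePoint i) = infinitePoint (κ i)) ∧
      ∀ i v, v ∈ spread h i ↔ B v ∈ spread h (κ i) := by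
  have hinf : ∀ P, Incident mul (φ P) .atInfty ↔ Incident mul P .atInfty := fun P => by
    rw [← hφ P, hψ]
  have hdir : ∀ i, ∃ j, φ (infinitePoint i) = infinitePoint j := fun i =>
    incident_atInfty_iff.1 ((hinf _).2 (incident_atInfty_iff.2 ⟨i, rfl⟩))
  choose κ₀ hκ₀ using hdir
  have hinj : Function.Injective κ₀ := fun i j hij => by
    refine infinitePoint_injective (φ.injective ?_)
    rw [hκ₀, hκ₀, hij]
  let κ : Equiv.Perm (Option F) := Equiv.ofBijective κ₀ (Finite.injective_iff_bijective.1 hinj)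
  have hκ : ∀ i, φ (infinitePoint i) = infinitePoint (κ i) := hκ₀
  have haff : ∀ v : F × F, ∃ w : F × F, φ (.affine v.1 v.2) = .affine w.1 w.2 := fun v => by
    have hv : ¬ Incident mul (φ (.affine v.1 v.2)) .atInfty := by
      rw [hinf]
      exact id
    rcases hP : φ (.affine v.1 v.2) with ⟨x, y⟩ | a | _
    · exact ⟨(x, y), rfl⟩
    · rw [hP] at hv
      exact absurd trivial hv
    · rw [hP] at hv
      exact absurd trivial hv
  choose A hA using haff
  have hsub : ∀ v w i, v - w ∈ spread h i ↔ A v - A w ∈ spread h (κ i) := by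
    intro v w i
    rw [sub_mem_spread_iff, sub_mem_spread_iff, ← hA, ← hA, ← hκ]
    constructor
    · rintro ⟨l, h1, h2, h3⟩
      exact ⟨ψ l, (hφ _ _).2 h1, (hφ _ _).2 h2, (hφ _ _).2 h3⟩
    · rintro ⟨l, h1, h2, h3⟩
      obtain ⟨l, rfl⟩ := ψ.surjective l
      exact ⟨l, (hφ _ _).1 h1, (hφ _ _).1 h2, (hφ _ _).1 h3⟩
  have hadd := map_add_of_spread (S := spread h) (A := fun v => A v - A 0) (κ := κ)
    (exists_mem_spread h) (eq_zero_of_mem_spread h)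
    (fun i => by
      obtain ⟨x, hx⟩ := exists_ne (0 : F)
      rcases i with _ | a
      · exact ⟨(x, 0), hx⟩
      · refine ⟨(0, x), fun h0 => hx ?_⟩
        exact ((mem_spread_some h).1 h0).trans (h.zero_mul a))
    κ.injective
    (fun p q i hpq => by
      rw [sub_sub_sub_cancel_right]
      exact (hsub p q i).1 hpq) (sub_self _)
  refine ⟨⟨⟨fun v => A v - A 0, sub_self _⟩, hadd⟩, A 0, κ, fun v => ?_, hκ, fun i v => ?_⟩
  · simpa using hA v
  · have := hsub v 0 i
    rwa [sub_zero] at this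

/-! ### The flag fixed by all collineations -/

/-- The inverses of the right multiplications by nonzero elements form, together with `0`, a set
closed under addition: `R_a⁻¹ + R_b⁻¹ = R_c⁻¹` for some `c` whenever `a, b ≠ 0` and `a ≠ -b`. -/
def InverseAddClosed (mul : F → F → F) : Prop :=
  ∀ a b : F, a ≠ 0 → b ≠ 0 → a + b ≠ 0 →
    ∃ c, ∀ x y, mul x a = mul y b → mul (x + y) c = mul x a

/-- If a collineation fixes the line at infinity and moves `(∞)`, then in coordinates adapted to
the image of `(∞)` the inverses of the right multiplications are the right multiplications up to
two additive bijections, and therefore inherit their closure under addition. -/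
theorem IsCollineationPair.inverseAddClosed [Finite F] [Nontrivial F]
    (h : IsPresemifieldMul mul) {φ : Equiv.Perm (PlanePoint F)} {ψ : Equiv.Perm (PlaneLine F)}
    (hφ : IsCollineationPair mul φ ψ) (hψ : ψ .atInfty = .atInfty)
    (hinf : φ .infty ≠ .infty) : InverseAddClosed mul := by
  obtain ⟨B, v₀, κ, -, hκ, hB⟩ := hφ.exists_addMonoidHom h hψ
  obtain ⟨a₀, ha₀⟩ : ∃ a₀, κ none = some a₀ := by
    rcases hn : κ none with _ | a₀
    · refine absurd ?_ hinf
      have := hκ none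
      rwa [hn] at this
    · exact ⟨a₀, rfl⟩
  obtain ⟨s₀, hs₀⟩ : ∃ s₀, κ (some s₀) = none := by
    rcases hn : κ.symm none with _ | s₀
    · rw [Equiv.symm_apply_eq, ha₀] at hn
      cases hn
    · exact ⟨s₀, by rw [← hn, κ.apply_symm_apply]⟩
  let X : F → F → F := fun x y => (B (x, y)).1
  let r : F → F := fun x => (B (x, 0)).2 - mul (B (x, 0)).1 a₀
  have hXadd : ∀ x y x' y', X (x + x') (y + y') = X x y + X x' y' := fun x y x' y' => by
    change (B ((x, y) + (x', y'))).1 = _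
    rw [map_add]
    rfl
  have hsnd : ∀ x y, (B (x, y)).2 = mul (X x y) a₀ + r x := fun x y => by
    have h0 : (B (0, y)).2 = mul (B (0, y)).1 a₀ := by
      have := (hB none (0, y)).1 rfl
      rw [ha₀] at this
      exact this
    have h1 : (x, y) = (x, 0) + ((0, y) : F × F) := by simp
    change _ = mul (B (x, y)).1 a₀ + r x
    rw [h1, map_add, Prod.snd_add, Prod.fst_add, h.add_left, h0]
    change _ = _ + ((B (x, 0)).2 - mul (B (x, 0)).1 a₀)
    abel
  have hradd : ∀ x y, r (x - y) = r x - r y := fun x y => by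
    have h1 : ((x - y, 0) : F × F) = (x, 0) - (y, 0) := by simp
    change (B (x - y, 0)).2 - mul (B (x - y, 0)).1 a₀ = _
    rw [h1, map_sub, Prod.snd_sub, Prod.fst_sub, h.sub_mul]
    change _ = ((B (x, 0)).2 - mul (B (x, 0)).1 a₀) - ((B (y, 0)).2 - mul (B (y, 0)).1 a₀)
    abel
  have hrinj : Function.Injective r := fun x y hxy => by
    have h0 : r (x - y) = 0 := by rw [hradd, hxy, sub_self]
    have h1 : (x - y, (0 : F)) ∈ spread h none := by
      rw [hB, ha₀]
      change (B (x - y, 0)).2 = mul (B (x - y, 0)).1 a₀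
      rw [hsnd, h0, add_zero]
    exact sub_eq_zero.1 h1
  have hrsurj := Finite.injective_iff_surjective.1 hrinj
  have hr0 : r 0 = 0 := by simpa using hradd 0 0
  -- `R_k⁻¹ (r x)` is the first coordinate of the image of the point `(x, x ∘ s)`.
  have hk : ∀ s k, κ (some s) = some (a₀ + k) → ∀ x, r x = mul (X x (mul x s)) k := by
    intro s k hs x
    have h1 := (hB (some s) (x, mul x s)).1 rfl
    rw [hs] at h1
    change (B (x, mul x s)).2 = mul (X x (mul x s)) (a₀ + k) at h1
    rw [hsnd, h.add_right] at h1
    exact add_left_cancel h1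
  have hX0 : ∀ x, X x (mul x s₀) = 0 := fun x => by
    have h1 := (hB (some s₀) (x, mul x s₀)).1 rfl
    rwa [hs₀] at h1
  have hpre : ∀ k, k ≠ 0 → ∃ s, κ (some s) = some (a₀ + k) := by
    intro k hk0
    rcases hn : κ.symm (some (a₀ + k)) with _ | s
    · rw [Equiv.symm_apply_eq, ha₀, Option.some_inj] at hn
      exact absurd (by simpa using hn) hk0
    · exact ⟨s, by rw [← hn, κ.apply_symm_apply]⟩
  intro a b ha hb hab
  obtain ⟨s, hs⟩ := hpre a ha
  obtain ⟨t, ht⟩ := hpre b hb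
  have hsum : ∀ z, X z (mul z s) + X z (mul z t) = X z (mul z (s + t - s₀)) := fun z => by
    have h1 := hXadd z (mul z s) z (mul z t)
    have h2 := hXadd z (mul z (s + t - s₀)) z (mul z s₀)
    rw [← h1, ← add_zero (X z (mul z (s + t - s₀))), ← hX0 z, ← h2, ← h.add_right, ← h.add_right,
      sub_add_cancel]
  have hxy : ∀ x y, mul x a = mul y b →
      ∃ z, r z = mul x a ∧ x = X z (mul z s) ∧ y = X z (mul z t) := by
    intro x y hxy
    obtain ⟨z, hz⟩ := hrsurj (mul x a)
    exact ⟨z, hz, h.mul_left_injective ha (hz.symm.trans (hk s a hs z)),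
      h.mul_left_injective hb ((hz.trans hxy).symm.trans (hk t b ht z))⟩
  rcases hn : κ (some (s + t - s₀)) with _ | m
  · -- Here `R_a⁻¹ = -R_b⁻¹`, which is excluded by `a + b ≠ 0`.
    have hst : s + t - s₀ = s₀ := Option.some_inj.1 (κ.injective (hn.trans hs₀.symm))
    obtain ⟨z, hz⟩ := exists_ne (0 : F)
    have h1 := hsum z
    rw [hst, hX0] at h1
    have h2 := hk s a hs z
    have h3 := hk t b ht z
    rw [← neg_eq_of_add_eq_zero_right h1, h.neg_mul] at h3
    have h4 : mul (X z (mul z s)) (a + b) = 0 := by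
      rw [h.add_right, ← h2, h3, neg_add_cancel]
    rcases h.eq_zero_or_eq_zero _ _ h4 with h5 | h5
    · rw [h5, h.zero_mul] at h2
      exact absurd (hrinj (h2.trans hr0.symm)) hz
    · exact absurd h5 hab
  · refine ⟨m - a₀, fun x y he => ?_⟩
    obtain ⟨z, hz, rfl, rfl⟩ := hxy x y he
    rw [hsum, ← hz, hk (s + t - s₀) (m - a₀) (by rw [hn, add_sub_cancel]) z]

/-- The conjugate of a translation group: it fixes every point of the image of the line at infinity
and is transitive on the points off that line. -/
theorem IsCollineationPair.exists_conj_translation (h : IsPresemifieldMul mul)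
    {φ : Equiv.Perm (PlanePoint F)} {ψ : Equiv.Perm (PlaneLine F)}
    (hφ : IsCollineationPair mul φ ψ) {P Q : PlanePoint F}
    (hP : ¬ Incident mul P (ψ .atInfty)) (hQ : ¬ Incident mul Q (ψ .atInfty)) :
    ∃ (θ : Equiv.Perm (PlanePoint F)) (η : Equiv.Perm (PlaneLine F)),
      IsCollineationPair mul θ η ∧ (∀ R, Incident mul R (ψ .atInfty) → θ R = R) ∧ θ P = Q := by
  have haff : ∀ R, ¬ Incident mul R (ψ .atInfty) → ∃ x y, φ (.affine x y) = R := by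
    intro R hR
    obtain ⟨R, rfl⟩ := φ.surjective R
    rw [hφ] at hR
    rcases R with ⟨x, y⟩ | a | _
    · exact ⟨x, y, rfl⟩
    · exact absurd trivial hR
    · exact absurd trivial hR
  obtain ⟨x, y, rfl⟩ := haff P hP
  obtain ⟨x', y', rfl⟩ := haff Q hQ
  refine ⟨_, _, (hφ.symm.trans (isCollineationPair_translation h (x' - x) (y' - y))).trans hφ,
    fun R hR => ?_, ?_⟩
  · obtain ⟨R, rfl⟩ := φ.surjective R
    rw [hφ] at hR
    rcases R with ⟨x, y⟩ | a | _
    · exact hR.elim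
    · simp [translation]
    · simp [translation]
  · simp [translation]

/-- If neither kind of inverse multiplications is closed under addition, then every collineation
fixes the line at infinity and the point `(∞)`. -/
theorem IsCollineationPair.fixes_flag [Finite F] [Nontrivial F] (h : IsPresemifieldMul mul)
    (hright : ¬ InverseAddClosed mul) (hleft : ¬ InverseAddClosed (flip mul))
    {φ : Equiv.Perm (PlanePoint F)} {ψ : Equiv.Perm (PlaneLine F)}
    (hφ : IsCollineationPair mul φ ψ) : ψ .atInfty = .atInfty ∧ φ .infty = .infty := by
  have hpoint : ∀ {θ : Equiv.Perm (PlanePoint F)} {η : Equiv.Perm (PlaneLine F)},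
      IsCollineationPair mul θ η → η .atInfty = .atInfty → θ .infty = .infty :=
    fun hθ hη => by_contra fun hne => hright (hθ.inverseAddClosed h hη hne)
  have hline : ∀ {θ : Equiv.Perm (PlanePoint F)} {η : Equiv.Perm (PlaneLine F)},
      IsCollineationPair mul θ η → θ .infty = .infty → η .atInfty = .atInfty := by
    intro θ η hθ hinf
    by_contra hne
    refine hleft (hθ.dual.inverseAddClosed h.flip ?_ ?_)
    · change SemifieldPlane.dual (θ .infty) = .atInfty
      rw [hinf]
      rfl
    · intro h0
      refine hne (SemifieldPlane.dual.symm.injective ?_)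
      exact h0
  have hψ : ψ .atInfty = .atInfty := by
    obtain ⟨u, hu⟩ := exists_ne (0 : F)
    rcases hm : ψ .atInfty with ⟨a, b⟩ | a | _
    · -- The group with axis `l_{a,b}` fixes `(a)`, hence contains a collineation that fixes the
      -- line at infinity and moves `(∞)`.
      obtain ⟨θ, η, hθ, hfix, hθP⟩ := hφ.exists_conj_translation h (P := .infty)
        (Q := .slope (a + u)) (by rw [hm]; exact id) (by
          rw [hm]
          intro h0
          exact hu (add_eq_left.1 h0))
      have ha : θ (.slope a) = .slope a := hfix _ (by rw [hm]; rfl)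
      have h1 : Incident mul (.slope a) (η .atInfty) := by
        rw [← ha, hθ]
        trivial
      have h2 : Incident mul (.slope (a + u)) (η .atInfty) := by
        rw [← hθP, hθ]
        trivial
      have hη : η .atInfty = .atInfty := by
        rcases hη : η .atInfty with ⟨c, d⟩ | c | _ <;> rw [hη] at h1 h2
        · have h3 : a = c := h1
          have h4 : a + u = c := h2
          exact absurd (add_eq_left.1 (h4.trans h3.symm)) hu
        · exact h1.elim
      have := hpoint hθ hη
      rw [hθP] at this
      cases this
    · -- The group with axis `l_a` fixes `(∞)` and moves `(0)` to an affine point.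
      obtain ⟨θ, η, hθ, hfix, hθP⟩ := hφ.exists_conj_translation h (P := .slope 0)
        (Q := .affine (a + u) 0) (by rw [hm]; exact id) (by
          rw [hm]
          intro h0
          exact hu (add_eq_left.1 h0))
      have hη := hline hθ (hfix _ (by rw [hm]; trivial))
      have h1 : Incident mul (θ (.slope 0)) (η .atInfty) := by
        rw [hθ]
        trivial
      rw [hθP, hη] at h1
      exact h1.elim
    · rfl
  exact ⟨hψ, hpoint hφ hψ⟩

end SemifieldPlane

/-! ### The symplectic presemifield -/

section Symplectic

variable {F : Type*} [Field F] [Finite F] [CharP F 2]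

open SemifieldPlane

theorem exists_eq_sq (y : F) : ∃ s, y = s ^ 2 :=
  ⟨(frobeniusEquiv F 2).symm y, (frobenius_apply_frobeniusEquiv_symm F 2 y).symm⟩

theorem symplecticMul_sq_right (x s : F) :
    symplecticMul x (s ^ 2) = x * s ^ 2 + absTrace x * s + absTrace (x * s) := by
  have h : (frobeniusEquiv F 2).symm (s ^ 2) = s := frobeniusEquiv_symm_apply_frobenius F 2 s
  rw [symplecticMul, h, ← mul_pow, absTrace_sq]

theorem symplecticMul_of_absTrace_eq_zero {x : F} (hx : absTrace x = 0) (y : F) :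
    symplecticMul x y = x * y + absTrace (x ^ 2 * y) := by
  rw [symplecticMul, hx, zero_mul, add_zero]

theorem symplecticMul_one (x : F) : symplecticMul x 1 = x := by
  rw [← one_pow 2, symplecticMul_sq_right]
  simp only [one_pow, mul_one]
  rw [add_assoc, CharTwo.add_self_eq_zero, add_zero]

/-- The Frobenius automorphism is an automorphism of the presemifield. -/
theorem symplecticMul_pow_two_pow (d : ℕ) (x y : F) :
    symplecticMul x y ^ 2 ^ d = symplecticMul (x ^ 2 ^ d) (y ^ 2 ^ d) := by
  have h01 : ∀ z : F, absTrace z ^ 2 ^ d = absTrace z := fun z => by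
    rcases absTrace_eq_zero_or_one z with h | h <;> simp [h]
  obtain ⟨s, rfl⟩ := exists_eq_sq y
  rw [← pow_mul s, mul_comm 2, pow_mul s, symplecticMul_sq_right, symplecticMul_sq_right,
    two_pow_add, two_pow_add, mul_pow, mul_pow, h01, h01, ← mul_pow x s, absTrace_two_pow,
    absTrace_two_pow, ← pow_mul s, ← pow_mul s, mul_comm 2]

theorem isPresemifieldMul_symplecticMul {n : ℕ} (hn : Odd n) (hF : Nat.card F = 2 ^ n) :
    IsPresemifieldMul (symplecticMul (F := F)) where
  add_left x y z := by
    obtain ⟨s, rfl⟩ := exists_eq_sq z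
    simp only [symplecticMul_sq_right, absTrace_add, add_mul]
    ring
  add_right x y z := by
    obtain ⟨s, rfl⟩ := exists_eq_sq y
    obtain ⟨t, rfl⟩ := exists_eq_sq z
    rw [← CharTwo.add_sq]
    simp only [symplecticMul_sq_right]
    rw [CharTwo.add_sq, mul_add x s t, absTrace_add]
    ring
  eq_zero_or_eq_zero x y hxy := by
    obtain ⟨s, rfl⟩ := exists_eq_sq y
    by_contra! hne
    have hx := hne.1
    have hs : s ≠ 0 := fun h0 => hne.2 (by rw [h0]; simp)
    have h1 : absTrace (1 : F) = 1 := absTrace_one hn hF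
    have h2 : (2 : F) = 0 := CharTwo.two_eq_zero
    rw [symplecticMul_sq_right] at hxy
    rcases absTrace_eq_zero_or_one x with hTx | hTx <;>
      rcases absTrace_eq_zero_or_one (x * s) with hTs | hTs <;> rw [hTx, hTs] at hxy
    · refine mul_ne_zero hx (pow_ne_zero 2 hs) ?_
      linear_combination hxy
    · have h3 : x * s = s⁻¹ := by
        field_simp
        linear_combination hxy - h2
      have h4 : x = s⁻¹ ^ 2 := by
        field_simp
        linear_combination hxy - h2
      rw [h4, absTrace_sq, ← h3, hTs] at hTx
      exact one_ne_zero hTx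
    · have h3 : x * s = 1 := mul_right_cancel₀ hs (by linear_combination hxy - s * h2)
      rw [h3, h1] at hTs
      exact one_ne_zero hTs
    · have h3 : x * s = 1 + s⁻¹ := by
        field_simp
        linear_combination hxy - (s + 1) * h2
      have h4 : x = s⁻¹ + s⁻¹ ^ 2 := by
        field_simp
        linear_combination hxy - (s + 1) * h2
      rw [h4, absTrace_add, absTrace_sq, CharTwo.add_self_eq_zero] at hTx
      exact zero_ne_one hTx

/-- A right multiplication `R_b` with `b ∉ {0, 1}` is not inverse to another one: comparison on a
common kernel of four trace functionals leaves only `R_{1/b}`, and `R_b R_{1/b} = 1` would make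
`b` quadratic over the prime field. -/
theorem not_inverseAddClosed_symplecticMul {n : ℕ} (hn : Odd n) (hn5 : 5 ≤ n)
    (hF : Nat.card F = 2 ^ n) : ¬ InverseAddClosed (symplecticMul (F := F)) := by
  intro hcl
  have h := isPresemifieldMul_symplecticMul hn hF
  have h2 : (2 : F) = 0 := CharTwo.two_eq_zero
  have hcard : 2 ^ 4 < Nat.card F := by
    rw [hF]; exact Nat.pow_lt_pow_right one_lt_two (by omega)
  obtain ⟨t, ht⟩ : ∃ t : F, t ∉ ({0, 1} : Set F) := by
    by_contra! hall
    have h3 : (Set.univ : Set F).ncard ≤ ({0, 1} : Set F).ncard :=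
      Set.ncard_le_ncard (fun t _ => hall t) (Set.toFinite _)
    rw [Set.ncard_univ, Set.ncard_pair zero_ne_one] at h3
    omega
  simp only [Set.mem_insert_iff, Set.mem_singleton_iff, not_or] at ht
  obtain ⟨ht0, ht1⟩ := ht
  -- The element `b` is taken to be `t²`.
  obtain ⟨b', hb'⟩ : ∃ b', ∀ y, symplecticMul (symplecticMul y (t ^ 2)) b' = y := by
    have h1 : 1 + t ^ 2 ≠ 0 := fun h0 => ht1 (by
      have h3 : (1 + t) ^ 2 = 0 := by rw [CharTwo.add_sq, one_pow, h0]
      exact ((CharTwo.add_eq_zero).1 (pow_eq_zero_iff two_ne_zero |>.1 h3)).symm)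
    obtain ⟨c, hc⟩ := hcl 1 (1 + t ^ 2) one_ne_zero h1 (by
      rw [← add_assoc, CharTwo.add_self_eq_zero, zero_add]
      exact pow_ne_zero 2 ht0)
    refine ⟨c + 1, fun y => ?_⟩
    have h3 := hc (symplecticMul y (1 + t ^ 2)) y (symplecticMul_one _)
    rw [symplecticMul_one, h.add_right, symplecticMul_one] at h3
    rw [h.add_right, symplecticMul_one]
    rw [show y + symplecticMul y (t ^ 2) + y = symplecticMul y (t ^ 2) by
      linear_combination y * h2] at h3
    linear_combination h3 + symplecticMul y (t ^ 2) * h2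
  obtain ⟨s, rfl⟩ := exists_eq_sq b'
  have hst : s * t = 1 := by
    obtain ⟨y, hy, hp⟩ := exists_ne_zero_forall_eq_zero (F := F)
      ![fun y => absTrace y, fun y => absTrace (y * t),
        fun y => absTrace (symplecticMul y (t ^ 2)),
        fun y => absTrace (symplecticMul y (t ^ 2) * s)]
      (by
        intro i x y
        fin_cases i <;> simp [h.add_left, add_mul, absTrace_add])
      (by
        intro i x
        fin_cases i <;> exact absTrace_eq_zero_or_one _) hcard
    have hp0 : absTrace y = 0 := hp 0
    have hp1 : absTrace (y * t) = 0 := hp 1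
    have hp2 : absTrace (symplecticMul y (t ^ 2)) = 0 := hp 2
    have hp3 : absTrace (symplecticMul y (t ^ 2) * s) = 0 := hp 3
    have h3 := hb' y
    rw [symplecticMul_sq_right, hp2, hp3, symplecticMul_sq_right, hp0, hp1] at h3
    have h4 : (s * t + 1) ^ 2 = 0 := by
      rw [CharTwo.add_sq]
      refine (mul_eq_zero.1 (?_ : y * _ = 0)).resolve_left hy
      linear_combination h3 + y * h2
    exact (CharTwo.add_eq_zero).1 (pow_eq_zero_iff two_ne_zero |>.1 h4)
  obtain ⟨y, hy⟩ := exists_absTrace_mul_eq_one ht0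
  have h3 := hb' y
  rw [mul_comm] at hy
  rw [symplecticMul_sq_right _ s, symplecticMul_sq_right, hy] at h3
  have hs0 : s ≠ 0 := left_ne_zero_of_mul_eq_one hst
  have hs1 : s ≠ 1 := fun h0 => ht1 (by rwa [h0, one_mul] at hst)
  have hquad : ∃ ε δ : F, (ε = 0 ∨ ε = 1) ∧ (δ = 0 ∨ δ = 1) ∧ s ^ 2 + ε * s + δ = 0 := by
    refine ⟨absTrace y + absTrace (y * t ^ 2 + absTrace y * t + 1),
      absTrace ((y * t ^ 2 + absTrace y * t + 1) * s), ?_, absTrace_eq_zero_or_one _, ?_⟩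
    · rcases absTrace_eq_zero_or_one y with ha | ha <;>
        rcases absTrace_eq_zero_or_one (y * t ^ 2 + absTrace y * t + 1) with hb | hb <;>
        rw [hb] <;> simp [ha, CharTwo.add_self_eq_zero]
    · linear_combination h3 - (y * (s * t + 1) + absTrace y * s) * hst
  obtain ⟨ε, δ, hε, hδ, hq⟩ := hquad
  rcases hε with rfl | rfl <;> rcases hδ with rfl | rfl
  · exact pow_ne_zero 2 hs0 (by linear_combination hq)
  · have h4 : (s + 1) ^ 2 = 0 := by rw [CharTwo.add_sq]; linear_combination hq
    exact hs1 ((CharTwo.add_eq_zero).1 (pow_eq_zero_iff two_ne_zero |>.1 h4))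
  · have h4 : s * (s + 1) = 0 := by linear_combination hq
    rcases mul_eq_zero.1 h4 with h5 | h5
    · exact hs0 h5
    · exact hs1 ((CharTwo.add_eq_zero).1 h5)
  · have h4 : absTrace (s ^ 2 + s) = 1 := by
      rw [show s ^ 2 + s = 1 by linear_combination hq - h2, absTrace_one hn hF]
    rw [absTrace_add, absTrace_sq, CharTwo.add_self_eq_zero] at h4
    exact zero_ne_one h4

theorem symplecticMul_leftInverse {x : F} (hx : absTrace x = 0) (hx0 : x ≠ 0) (v : F) :
    symplecticMul x ((v + absTrace (x * v)) / x) = v := by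
  rw [symplecticMul_of_absTrace_eq_zero hx]
  have h1 : x * ((v + absTrace (x * v)) / x) = v + absTrace (x * v) := by field_simp
  have h2 : x ^ 2 * ((v + absTrace (x * v)) / x) = x * v + x * absTrace (x * v) := by field_simp
  have h3 : absTrace (x * absTrace (x * v)) = 0 := by
    rcases absTrace_eq_zero_or_one (x * v) with h | h <;> simp [h, hx, absTrace_zero]
  rw [h1, h2, absTrace_add, h3, add_zero, add_assoc, CharTwo.add_self_eq_zero, add_zero]

/-- For distinct nonzero `x, y` of trace zero the left multiplications satisfy
`L_x⁻¹ v = (v + Tr(x v)) / x`. On a common kernel of three trace functionals,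
`L_x⁻¹ + L_y⁻¹ = L_z⁻¹` forces `Tr z = 0` and `1 / x + 1 / y = 1 / z`, and then the terms of rank
one do not cancel. -/
theorem not_inverseAddClosed_flip_symplecticMul {n : ℕ} (hn : Odd n) (hn5 : 5 ≤ n)
    (hF : Nat.card F = 2 ^ n) : ¬ InverseAddClosed (flip (symplecticMul (F := F))) := by
  intro hcl
  have h := isPresemifieldMul_symplecticMul hn hF
  have h2 : (2 : F) = 0 := CharTwo.two_eq_zero
  have hcard : 2 ^ 4 < Nat.card F := by
    rw [hF]; exact Nat.pow_lt_pow_right one_lt_two (by omega)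
  obtain ⟨x, hx0, hp⟩ := exists_ne_zero_forall_eq_zero (F := F) ![fun y => absTrace y]
    (by
      intro i x y
      fin_cases i
      exact absTrace_add x y)
    (by
      intro i x
      fin_cases i
      exact absTrace_eq_zero_or_one _) (by omega)
  have hx : absTrace x = 0 := hp 0
  obtain ⟨w, hw⟩ := exists_absTrace_mul_eq_one hx0
  obtain ⟨y, hy0, hp⟩ := exists_ne_zero_forall_eq_zero (F := F)
    ![fun y => absTrace y, fun y => absTrace (y * w)]
    (by
      intro i x y
      fin_cases i <;> simp [add_mul, absTrace_add])
    (by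
      intro i x
      fin_cases i <;> exact absTrace_eq_zero_or_one _) (by omega)
  have hy : absTrace y = 0 := hp 0
  have hyw : absTrace (y * w) = 0 := hp 1
  have hxy : x ≠ y := by
    rintro rfl
    exact zero_ne_one (hyw.symm.trans hw)
  obtain ⟨z, hz⟩ := hcl x y hx0 hy0 (by rwa [Ne, CharTwo.add_eq_zero])
  have hE : ∀ v, symplecticMul z ((v + absTrace (x * v)) / x + (v + absTrace (y * v)) / y) = v :=
    fun v => by
      have h3 := hz ((v + absTrace (x * v)) / x) ((v + absTrace (y * v)) / y) (by
        simp only [flip]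
        rw [symplecticMul_leftInverse hx hx0, symplecticMul_leftInverse hy hy0])
      simp only [flip] at h3
      rwa [symplecticMul_leftInverse hx hx0] at h3
  -- `r = 1 / x + 1 / y` is written as a square.
  obtain ⟨r, hr⟩ := exists_eq_sq (x⁻¹ + y⁻¹)
  have hr0 : r ≠ 0 := by
    rintro rfl
    rw [zero_pow two_ne_zero, CharTwo.add_eq_zero, inv_inj] at hr
    exact hxy hr
  have hker : ∀ v, absTrace (x * v ^ 2) = 0 → absTrace (y * v ^ 2) = 0 →
      absTrace (z * (r * v)) = 0 → z * (r * v) ^ 2 + absTrace z * (r * v) = v ^ 2 := by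
    intro v h3 h4 h5
    have h6 := hE (v ^ 2)
    rw [h3, h4, add_zero, div_eq_mul_inv, div_eq_mul_inv, ← mul_add, hr, mul_comm, ← mul_pow,
      symplecticMul_sq_right, h5, add_zero] at h6
    exact h6
  let p : Fin 3 → F → F := ![fun v => absTrace (x * v ^ 2), fun v => absTrace (y * v ^ 2),
    fun v => absTrace (z * (r * v))]
  have hpadd : ∀ i v w, p i (v + w) = p i v + p i w := by
    intro i v w
    fin_cases i <;> simp [p, CharTwo.add_sq, mul_add, absTrace_add]
  have hp01 : ∀ i v, p i v = 0 ∨ p i v = 1 := by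
    intro i v
    fin_cases i <;> exact absTrace_eq_zero_or_one _
  obtain ⟨v, hv0, hpv⟩ := exists_ne_zero_forall_eq_zero p hpadd hp01 (by omega)
  have hv := hker v (hpv 0) (hpv 1) (hpv 2)
  have hTz : absTrace z = 0 := by
    refine (absTrace_eq_zero_or_one z).resolve_right fun hTz => ?_
    -- A second zero of the three functionals contradicts `z r² v + r = v`.
    obtain ⟨t, ht⟩ := exists_absTrace_mul_eq_one hv0
    obtain ⟨v', hv0', hpv'⟩ := exists_ne_zero_forall_eq_zero
      (Fin.cons (fun u => absTrace (u * t)) p : Fin 4 → F → F)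
      (by
        intro i
        refine Fin.cases ?_ ?_ i
        · intro u u'
          simp [add_mul, absTrace_add]
        · intro j
          simpa using hpadd j)
      (by
        intro i
        refine Fin.cases ?_ ?_ i
        · intro u
          exact absTrace_eq_zero_or_one _
        · intro j
          simpa using hp01 j) hcard
    have hv' := hker v' (hpv' 1) (hpv' 2) (hpv' 3)
    have hne : absTrace (v' * t) = 0 := hpv' 0
    rw [hTz] at hv hv'
    have h3 : z * r ^ 2 * v + r = v := mul_right_cancel₀ hv0 (by linear_combination hv)
    have h4 : z * r ^ 2 * v' + r = v' := mul_right_cancel₀ hv0' (by linear_combination hv')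
    have h5 : (z * r ^ 2 + 1) * (v + v') = 0 := by
      linear_combination h3 + h4 + (v + v' - r) * h2
    rcases mul_eq_zero.1 h5 with h6 | h6
    · exact hr0 (by linear_combination h3 - v * h6 + v * h2)
    · rw [← (CharTwo.add_eq_zero).1 h6, ht] at hne
      exact one_ne_zero hne
  have hzr : z * r ^ 2 = 1 := by
    rw [hTz] at hv
    exact mul_right_cancel₀ (pow_ne_zero 2 hv0) (by linear_combination hv)
  have hz0 : z ≠ 0 := left_ne_zero_of_mul_eq_one hzr
  obtain ⟨u, hxu, hyu⟩ := exists_absTrace_mul_eq_one_and_zero hx0 hxy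
  have hu := hE u
  rw [hxu, hyu, symplecticMul_of_absTrace_eq_zero hTz] at hu
  have h3 : z / x + absTrace (z ^ 2 * ((u + 1) / x + (u + 0) / y)) = 0 := by
    have h4 : z * ((u + 1) / x + (u + 0) / y) = u + z / x := by
      rw [← hr] at hzr
      linear_combination u * hzr
    rw [h4] at hu
    linear_combination hu
  rcases absTrace_eq_zero_or_one (z ^ 2 * ((u + 1) / x + (u + 0) / y)) with h4 | h4 <;>
    rw [h4] at h3
  · rw [add_zero] at h3
    exact div_ne_zero hz0 hx0 h3
  · have h5 : z = x := by
      have := (CharTwo.add_eq_zero).1 h3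
      field_simp at this
      exact this
    rw [h5, ← hr, mul_add, mul_inv_cancel₀ hx0, add_eq_left] at hzr
    exact mul_ne_zero hx0 (inv_ne_zero hy0) hzr

/-! ### The hyperovals -/

theorem absTrace_pow_two_pow_add_self (d : ℕ) (y : F) : absTrace (y ^ 2 ^ d + y) = 0 := by
  rw [absTrace_add, absTrace_two_pow, CharTwo.add_self_eq_zero]

/-- The map `y ↦ y ^ 2 ^ d / y` is injective on nonzero elements, as `2 ^ d - 1` is prime to
`2 ^ n - 1`. -/
theorem eq_of_mul_pow_two_pow_add_self_eq {n d : ℕ} (hF : Nat.card F = 2 ^ n)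
    (hnd : Nat.gcd n d = 1) {a y z : F} (hy0 : y ≠ 0) (hz0 : z ≠ 0)
    (ha : a ≠ 0) (hy : (y ^ 2 ^ d + y) * a = y) (hz : (z ^ 2 ^ d + z) * a = z) : y = z := by
  have h1 : (y / z) ^ 2 ^ d = y / z := by
    have hzd : z ^ 2 ^ d ≠ 0 := pow_ne_zero _ hz0
    rw [div_pow, div_eq_div_iff hzd hz0]
    refine mul_right_cancel₀ ha ?_
    linear_combination z * hy - y * hz
  rcases eq_zero_or_one_of_pow_two_pow_eq hF hnd h1 with h2 | h2
  · exact absurd h2 (div_ne_zero hy0 hz0)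
  · exact (div_eq_one_iff_eq hz0).1 h2

/-- The kernel of `y ↦ y + (y ^ 2 ^ d + y) ∘ a` has at most one nonzero element: such an element
satisfies `(y ^ 2 ^ d + y) a = y + ε` with `ε ∈ {0, 1}`, and so `y + ε` is determined. -/
theorem eq_of_eq_symplecticMul {n d : ℕ} (hn : Odd n) (hF : Nat.card F = 2 ^ n)
    (hnd : Nat.gcd n d = 1) {a y z : F} (hy0 : y ≠ 0) (hz0 : z ≠ 0)
    (hy : y = symplecticMul (y ^ 2 ^ d + y) a) (hz : z = symplecticMul (z ^ 2 ^ d + z) a) :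
    y = z := by
  have h := isPresemifieldMul_symplecticMul hn hF
  have ha : a ≠ 0 := by
    rintro rfl
    rw [h.mul_zero] at hy
    exact hy0 hy
  have hone : ((1 : F) ^ 2 ^ d + 1) = 0 := by rw [one_pow, CharTwo.add_self_eq_zero]
  have hnot1 : ∀ y : F, y ≠ 0 → y = symplecticMul (y ^ 2 ^ d + y) a → y ≠ 1 := by
    rintro _ h0 hy rfl
    rw [hone, h.zero_mul] at hy
    exact h0 hy
  have hcase : ∀ y : F, y = symplecticMul (y ^ 2 ^ d + y) a →
      (y ^ 2 ^ d + y) * a = y ∨ ((y + 1) ^ 2 ^ d + (y + 1)) * a = y + 1 := by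
    intro y hy
    have h2 : (2 : F) = 0 := CharTwo.two_eq_zero
    rw [symplecticMul_of_absTrace_eq_zero (absTrace_pow_two_pow_add_self d y)] at hy
    rcases absTrace_eq_zero_or_one ((y ^ 2 ^ d + y) ^ 2 * a) with h3 | h3 <;> rw [h3] at hy
    · left
      linear_combination -hy
    · right
      rw [two_pow_add, one_pow]
      linear_combination -hy + (a - 1) * h2
  have hne1 : ∀ y : F, y ≠ 1 → y + 1 ≠ 0 := fun y hy h0 => hy ((CharTwo.add_eq_zero).1 h0)
  have hy1 := hnot1 y hy0 hy
  have hz1 := hnot1 z hz0 hz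
  -- If `z = y + 1`, then `1` would be in the kernel as well.
  have hmix : z ≠ y + 1 := by
    rintro rfl
    refine hnot1 1 one_ne_zero ?_ rfl
    rw [two_pow_add, show y ^ 2 ^ d + 1 ^ 2 ^ d + (y + 1) = (y ^ 2 ^ d + y) + (1 ^ 2 ^ d + 1) by
      ring, h.add_left, ← hy] at hz
    exact add_left_cancel hz
  rcases hcase y hy with h3 | h3 <;> rcases hcase z hz with h4 | h4
  · exact eq_of_mul_pow_two_pow_add_self_eq hF hnd hy0 hz0 ha h3 h4
  · have h5 := eq_of_mul_pow_two_pow_add_self_eq hF hnd hy0 (hne1 z hz1) ha h3 h4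
    exact absurd (by rw [h5, add_assoc, CharTwo.add_self_eq_zero, add_zero]) hmix
  · exact absurd (eq_of_mul_pow_two_pow_add_self_eq hF hnd (hne1 y hy1) hz0 ha h3 h4).symm hmix
  · exact add_right_cancel
      (eq_of_mul_pow_two_pow_add_self_eq hF hnd (hne1 y hy1) (hne1 z hz1) ha h3 h4)

/-- Two points `(y ^ 2 ^ d + y, y)` of a line of slope `a` differ by an element of the kernel of
`y ↦ y + (y ^ 2 ^ d + y) ∘ a`. -/
theorem add_eq_symplecticMul_of_incident {n d : ℕ} (hn : Odd n) (hF : Nat.card F = 2 ^ n)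
    {a b y z : F}
    (hy : Incident symplecticMul (.affine (y ^ 2 ^ d + y) y) (.line a b))
    (hz : Incident symplecticMul (.affine (z ^ 2 ^ d + z) z) (.line a b)) :
    y + z = symplecticMul ((y + z) ^ 2 ^ d + (y + z)) a := by
  have h := isPresemifieldMul_symplecticMul hn hF
  have h2 : (2 : F) = 0 := CharTwo.two_eq_zero
  change y = symplecticMul (y ^ 2 ^ d + y) a + b at hy
  change z = symplecticMul (z ^ 2 ^ d + z) a + b at hz
  rw [two_pow_add, show y ^ 2 ^ d + z ^ 2 ^ d + (y + z) = (y ^ 2 ^ d + y) + (z ^ 2 ^ d + z) by ring,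
    h.add_left]
  linear_combination hy + hz + b * h2

theorem slope_ne_of_incident {n d : ℕ} (hn : Odd n) (hF : Nat.card F = 2 ^ n) {a b y z : F}
    (hyz : y ≠ z) (hy : Incident symplecticMul (.affine (y ^ 2 ^ d + y) y) (.line a b))
    (hz : Incident symplecticMul (.affine (z ^ 2 ^ d + z) z) (.line a b)) : a ≠ 0 ∧ a ≠ 1 := by
  have h := isPresemifieldMul_symplecticMul hn hF
  have hu := add_eq_symplecticMul_of_incident hn hF hy hz
  have hu0 : y + z ≠ 0 := fun h0 => hyz ((CharTwo.add_eq_zero).1 h0)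
  constructor
  · rintro rfl
    rw [h.mul_zero] at hu
    exact hu0 hu
  · rintro rfl
    rw [symplecticMul_one, right_eq_add] at hu
    exact pow_ne_zero _ hu0 hu

theorem mem_ovalSet_incident_line {d : ℕ} {P : PlanePoint F} {a b : F} (hP : P ∈ ovalSet F d)
    (hl : Incident symplecticMul P (.line a b)) :
    (∃ y, P = .affine (y ^ 2 ^ d + y) y) ∨ (P = .slope a ∧ (a = 0 ∨ a = 1)) := by
  rcases hP with hP | rfl | rfl
  · exact Or.inl hP
  · have h0 : 0 = a := hl
    exact Or.inr ⟨by rw [h0], Or.inl h0.symm⟩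
  · have h0 : 1 = a := hl
    exact Or.inr ⟨by rw [h0], Or.inr h0.symm⟩

theorem ncard_ovalSet {F : Type*} [Field F] [Finite F] (d : ℕ) :
    (ovalSet F d).ncard = Nat.card F + 2 := by
  have h1 : {P : PlanePoint F | ∃ y : F, P = .affine (y ^ 2 ^ d + y) y} =
      (fun y : F => PlanePoint.affine (y ^ 2 ^ d + y) y) '' Set.univ := by
    ext P
    simp [eq_comm]
  have h2 : Function.Injective fun y : F => PlanePoint.affine (y ^ 2 ^ d + y) y :=
    fun y z hyz => (PlanePoint.affine.inj hyz).2
  rw [ovalSet, h1, Set.ncard_union_eq, Set.ncard_image_of_injective _ h2, Set.ncard_univ,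
    Set.ncard_pair]
  · simp
  · rw [Set.disjoint_left]
    rintro _ ⟨y, -, rfl⟩ hy
    simp at hy

theorem isHyperoval_ovalSet {n d : ℕ} (hn : Odd n) (hF : Nat.card F = 2 ^ n)
    (hnd : Nat.gcd n d = 1) : IsHyperoval symplecticMul (ovalSet F d) := by
  refine ⟨ncard_ovalSet d, ?_⟩
  rintro P hP Q hQ R hR hPQ hPR hQR ⟨⟨a, b⟩ | a | _, hPl, hQl, hRl⟩
  · have hpair : ∀ y z : F, PlanePoint.affine (y ^ 2 ^ d + y) y ≠ .affine (z ^ 2 ^ d + z) z →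
        y ≠ z := by
      rintro y _ hyz rfl
      exact hyz rfl
    have hslope : ∀ y z : F, PlanePoint.affine (y ^ 2 ^ d + y) y ≠ .affine (z ^ 2 ^ d + z) z →
        Incident symplecticMul (.affine (y ^ 2 ^ d + y) y) (.line a b) →
        Incident symplecticMul (.affine (z ^ 2 ^ d + z) z) (.line a b) → ¬ (a = 0 ∨ a = 1) :=
      fun y z hyz hy hz => not_or.2 (slope_ne_of_incident hn hF (hpair y z hyz) hy hz)
    rcases mem_ovalSet_incident_line hP hPl with ⟨x, rfl⟩ | ⟨rfl, hP1⟩ <;>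
      rcases mem_ovalSet_incident_line hQ hQl with ⟨y, rfl⟩ | ⟨rfl, hQ1⟩
    · rcases mem_ovalSet_incident_line hR hRl with ⟨z, rfl⟩ | ⟨rfl, hR1⟩
      · have hxy := hpair x y hPQ
        have hxz := hpair x z hPR
        refine hpair y z hQR (add_left_cancel (a := x) ?_)
        exact eq_of_eq_symplecticMul hn hF hnd
          (fun h0 => hxy ((CharTwo.add_eq_zero).1 h0)) (fun h0 => hxz ((CharTwo.add_eq_zero).1 h0))
          (add_eq_symplecticMul_of_incident hn hF hPl hQl)
          (add_eq_symplecticMul_of_incident hn hF hPl hRl)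
      · exact hslope x y hPQ hPl hQl hR1
    · rcases mem_ovalSet_incident_line hR hRl with ⟨z, rfl⟩ | ⟨rfl, hR1⟩
      · exact hslope x z hPR hPl hRl hQ1
      · exact hQR rfl
    · rcases mem_ovalSet_incident_line hR hRl with ⟨z, rfl⟩ | ⟨rfl, hR1⟩
      · exact hslope y z hQR hQl hRl hP1
      · exact hPR rfl
    · exact hPQ rfl
  · have haff : ∀ P ∈ ovalSet F d, Incident symplecticMul P (.vertical a) →
        ∃ y, P = .affine (y ^ 2 ^ d + y) y ∧ y ^ 2 ^ d + y = a := by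
      rintro _ (⟨y, rfl⟩ | rfl | rfl) hl
      · exact ⟨y, rfl, hl⟩
      · exact hl.elim
      · exact hl.elim
    obtain ⟨x, rfl, hx⟩ := haff P hP hPl
    obtain ⟨y, rfl, hy⟩ := haff Q hQ hQl
    obtain ⟨z, rfl, hz⟩ := haff R hR hRl
    have hdiff : ∀ u v : F, PlanePoint.affine (u ^ 2 ^ d + u) u ≠ .affine (v ^ 2 ^ d + v) v →
        u ^ 2 ^ d + u = a → v ^ 2 ^ d + v = a → u + v = 1 := by
      intro u v huv hu hv
      have h1 : (u + v) ^ 2 ^ d = u + v := by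
        rw [← CharTwo.add_eq_zero, two_pow_add]
        linear_combination hu + hv + a * CharTwo.two_eq_zero (R := F)
      refine (eq_zero_or_one_of_pow_two_pow_eq hF hnd h1).resolve_left fun h0 => huv ?_
      rw [(CharTwo.add_eq_zero).1 h0]
    have h1 := (hdiff x y hPQ hx hy).trans (hdiff x z hPR hx hz).symm
    rw [add_left_cancel h1] at hQR
    exact hQR rfl
  · have hslope : ∀ P ∈ ovalSet F d, Incident symplecticMul P .atInfty →
        P = .slope 0 ∨ P = .slope 1 := by
      rintro _ (⟨y, rfl⟩ | rfl | rfl) hl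
      · exact hl.elim
      · exact Or.inl rfl
      · exact Or.inr rfl
    rcases hslope P hP hPl with rfl | rfl <;> rcases hslope Q hQ hQl with rfl | rfl <;>
      rcases hslope R hR hRl with rfl | rfl <;> simp_all

/-! ### Autotopisms and equivalence of the hyperovals -/

/-- Let `(f, k, f)` be an autotopism for which `f` conjugates one generator `x ↦ x ^ 2 ^ d` of the
Galois group to another one, `x ↦ x ^ 2 ^ e`. The generators coincide: `f` fixes `1` and preserves
the trace, so `f (x a) = f x * k a + ε` with `ε ∈ {0, 1}` for `x, a` of trace zero. The symmetry of
the left-hand side makes `k` proportional to `f` on the trace-zero hyperplane, the factor is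
invariant under `x ↦ x ^ 2 ^ e` and hence `1`, and `a = x` shows that `f` commutes with squaring. -/
theorem modEq_of_autotopism {n d e : ℕ} (hn : Odd n) (hn5 : 5 ≤ n) (hF : Nat.card F = 2 ^ n)
    (hnd : Nat.gcd n d = 1) (hne : Nat.gcd n e = 1) {f k : F → F}
    (hadd : ∀ x y, f (x + y) = f x + f y) (hinj : Function.Injective f)
    (hmul : ∀ x s, f (symplecticMul x s) = symplecticMul (f x) (k s))
    (hfrob : ∀ x, f (x ^ 2 ^ d) = f x ^ 2 ^ e) : (d : ℤ) ≡ e [ZMOD n] := by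
  have h := isPresemifieldMul_symplecticMul hn hF
  have h2 : (2 : F) = 0 := CharTwo.two_eq_zero
  have hT1 : absTrace (1 : F) = 1 := absTrace_one hn hF
  have hcard : 2 ^ 4 < Nat.card F := by
    rw [hF]; exact Nat.pow_lt_pow_right one_lt_two (by omega)
  have hf0 : f 0 = 0 := by
    have := hadd 0 0
    rw [add_zero] at this
    exact left_eq_add.1 this
  have hfne : ∀ {x}, x ≠ 0 → f x ≠ 0 := fun hx h0 => hx (hinj (h0.trans hf0.symm))
  have hf1 : f 1 = 1 := by
    have h1 := hfrob 1
    rw [one_pow] at h1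
    exact (eq_zero_or_one_of_pow_two_pow_eq hF hne h1.symm).resolve_left (hfne one_ne_zero)
  have hf01 : ∀ x, f (absTrace x) = absTrace x := fun x => by
    rcases absTrace_eq_zero_or_one x with hx | hx <;> rw [hx] <;> assumption
  have hfT0 : ∀ x, absTrace x = 0 → absTrace (f x) = 0 := fun x hx => by
    obtain ⟨y, rfl⟩ := exists_eq_of_absTrace_eq_zero hn hF hnd hx
    rw [hadd, hfrob, absTrace_pow_two_pow_add_self]
  have hfT : ∀ x, absTrace (f x) = absTrace x := fun x => by
    rcases absTrace_eq_zero_or_one x with hx | hx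
    · rw [hfT0 x hx, hx]
    · have h3 := hfT0 (x + 1) (by rw [absTrace_add, hx, hT1, CharTwo.add_self_eq_zero])
      rw [hadd, hf1, absTrace_add, hT1] at h3
      rw [hx]
      exact (CharTwo.add_eq_zero).1 h3
  have hk1 : ∀ s, symplecticMul 1 (k s) = f (symplecticMul 1 s) := fun s => by
    rw [hmul, hf1]
  have hkne : ∀ {s}, s ≠ 0 → k s ≠ 0 := by
    intro s hs h0
    have h3 := hk1 s
    rw [h0, h.mul_zero] at h3
    refine hs ((h.eq_zero_or_eq_zero 1 s ?_).resolve_left one_ne_zero)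
    exact hinj (h3.symm.trans hf0.symm)
  have hkadd : ∀ s t, k (s + t) = k s + k t := fun s t => by
    refine h.mul_right_injective one_ne_zero ?_
    simp only
    rw [h.add_right, hk1, hk1, hk1, h.add_right, hadd]
  have hkfrob : ∀ s, k (s ^ 2 ^ d) = k s ^ 2 ^ e := fun s => by
    refine h.mul_right_injective one_ne_zero ?_
    have h3 := symplecticMul_pow_two_pow d 1 s
    have h4 := symplecticMul_pow_two_pow e 1 (k s)
    rw [one_pow] at h3 h4
    simp only
    rw [hk1, ← h3, hfrob, ← hk1, h4]
  have hprod : ∀ x s, absTrace x = 0 →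
      f (x * s) + absTrace (x ^ 2 * s) = f x * k s + absTrace (f x ^ 2 * k s) := by
    intro x s hx
    have h3 := hmul x s
    rwa [symplecticMul_of_absTrace_eq_zero hx, hadd, hf01,
      symplecticMul_of_absTrace_eq_zero (hfT0 x hx)] at h3
  have hδ : ∀ x a, absTrace x = 0 → absTrace a = 0 →
      f x * k a + f a * k x = 0 ∨ f x * k a + f a * k x = 1 := by
    intro x a hx ha
    have h3 := hprod x a hx
    have h4 := hprod a x ha
    rw [mul_comm a x] at h4
    have h5 : f x * k a + f a * k x = absTrace (x ^ 2 * a) + absTrace (a ^ 2 * x) +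
        absTrace (f x ^ 2 * k a) + absTrace (f a ^ 2 * k x) := by
      linear_combination -h3 - h4 +
        (f (x * a) - absTrace (f x ^ 2 * k a) - absTrace (f a ^ 2 * k x)) * h2
    rw [h5, ← absTrace_add, ← absTrace_add, ← absTrace_add]
    exact absTrace_eq_zero_or_one _
  have hπ : ∀ x : F, absTrace (x + absTrace x) = 0 := fun x => by
    rw [absTrace_add, absTrace_absTrace hn hF, CharTwo.add_self_eq_zero]
  -- For `a, b` of trace zero, comparison with a common zero `x` of `δ_a` and `δ_b`, where
  -- `δ_a x = f x * k a + f a * k x`. The projection `x ↦ x + Tr x` extends `δ_a` to `F`.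
  have hprop : ∀ a b, absTrace a = 0 → absTrace b = 0 → k a * f b = k b * f a := by
    intro a b ha hb
    let δ : F → F → F := fun a x =>
      f (x + absTrace x) * k a + f a * k (x + absTrace x)
    have hδadd : ∀ a x y, δ a (x + y) = δ a x + δ a y := fun a x y => by
      simp only [δ]
      rw [absTrace_add, add_add_add_comm, hadd, hkadd]
      ring
    obtain ⟨x, hx0, hx⟩ := exists_ne_zero_forall_eq_zero (F := F)
      ![fun x => absTrace x, δ a, δ b]
      (by
        intro i x y
        fin_cases i
        · exact absTrace_add x y
        · exact hδadd a x y
        · exact hδadd b x y)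
      (by
        intro i x
        fin_cases i
        · exact absTrace_eq_zero_or_one x
        · exact hδ _ _ (hπ x) ha
        · exact hδ _ _ (hπ x) hb) (by omega)
    have hxT : absTrace x = 0 := hx 0
    have hxa : δ a x = 0 := hx 1
    have hxb : δ b x = 0 := hx 2
    simp only [δ, hxT, add_zero] at hxa hxb
    refine mul_left_cancel₀ (hfne hx0) ?_
    linear_combination f b * hxa - f a * hxb
  obtain ⟨b, hb0, hb⟩ : ∃ b : F, b ≠ 0 ∧ absTrace b = 0 := by
    obtain ⟨b, hb0, hb⟩ := exists_ne_zero_forall_eq_zero (F := F) ![fun y => absTrace y]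
      (by
        intro i x y
        fin_cases i
        exact absTrace_add x y)
      (by
        intro i x
        fin_cases i
        exact absTrace_eq_zero_or_one _) (by omega)
    exact ⟨b, hb0, hb 0⟩
  have hkf : ∀ a, absTrace a = 0 → k a = f a := by
    have hc : (k b / f b) ^ 2 ^ e = k b / f b := by
      have h3 := hprop (b ^ 2 ^ d) b (by rw [absTrace_two_pow, hb]) hb
      rw [hfrob, hkfrob] at h3
      rw [div_pow, div_eq_div_iff (pow_ne_zero _ (hfne hb0)) (hfne hb0), h3]
    have hc1 := (eq_zero_or_one_of_pow_two_pow_eq hF hne hc).resolve_left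
      (div_ne_zero (hkne hb0) (hfne hb0))
    rw [div_eq_one_iff_eq (hfne hb0)] at hc1
    intro a ha
    have h3 := hprop a b ha hb
    rw [hc1, mul_comm (f b)] at h3
    exact mul_right_cancel₀ (hfne hb0) h3
  have hsq0 : ∀ x, absTrace x = 0 → f (x ^ 2) = f x ^ 2 := by
    intro x hx
    have h3 := hprod x x hx
    rw [hkf x hx, ← sq, ← sq] at h3
    have h4 := congrArg absTrace h3
    rw [absTrace_add, absTrace_add, absTrace_absTrace hn hF, absTrace_absTrace hn hF, hfT,
      absTrace_sq, absTrace_sq, hfT, add_left_cancel_iff] at h4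
    rw [h4] at h3
    exact add_right_cancel h3
  have hsq : ∀ x, f (x ^ 2) = f x ^ 2 := by
    intro x
    have h3 := hsq0 (x + absTrace x) (hπ x)
    have h4 : (absTrace x) ^ 2 = absTrace x := by
      rcases absTrace_eq_zero_or_one x with hx | hx <;> simp [hx]
    rw [CharTwo.add_sq, h4, hadd, hadd, hf01, CharTwo.add_sq, h4] at h3
    exact add_right_cancel h3
  have hpow : ∀ m x, f (x ^ 2 ^ m) = f x ^ 2 ^ m := by
    intro m x
    induction m with
    | zero => simp
    | succ m ih => rw [pow_succ, pow_mul, hsq, ih, ← pow_mul]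
  refine modEq_of_forall_pow_two_pow_eq hF fun w => ?_
  obtain ⟨x, rfl⟩ := Finite.injective_iff_surjective.1 hinj w
  rw [← hpow, hfrob]

/-- The shear `(x, y) ↦ (x, y + x)` maps `O_d` onto `O_e` when `d ≡ -e`. -/
theorem equivalent_ovalSet_of_modEq_neg {n d e : ℕ} (hn : Odd n) (hF : Nat.card F = 2 ^ n)
    (hde : (d : ℤ) ≡ -e [ZMOD n]) :
    Equivalent symplecticMul (ovalSet F d) (ovalSet F e) := by
  have h := isPresemifieldMul_symplecticMul hn hF
  have hpow : ∀ y : F, (y ^ 2 ^ d) ^ 2 ^ e = y := fun y => by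
    have h1 : ((d + e : ℕ) : ℤ) ≡ (0 : ℕ) [ZMOD n] := by
      have := hde.add_right (e : ℤ)
      simpa using this
    rw [← pow_mul, ← pow_add, pow_two_pow_eq_of_modEq hF h1, pow_zero, pow_one]
  refine ⟨shear symplecticMul 1, isCollineation_shear h 1, ?_⟩
  have hsub : shear symplecticMul 1 '' ovalSet F d ⊆ ovalSet F e := by
    rintro _ ⟨_, ⟨y, rfl⟩ | rfl | rfl, rfl⟩
    · left
      refine ⟨y ^ 2 ^ d, ?_⟩
      have h1 : y + (y ^ 2 ^ d + y) = y ^ 2 ^ d := by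
        linear_combination y * CharTwo.two_eq_zero (R := F)
      simp only [shear, Equiv.coe_fn_mk, symplecticMul_one]
      rw [h1, hpow, add_comm y]
    · right; right
      simp [shear]
    · right; left
      simp [shear, CharTwo.add_self_eq_zero]
  refine Set.eq_of_subset_of_ncard_le hsub ?_ ?_
  · rw [Set.ncard_image_of_injective _ (Equiv.injective _), ncard_ovalSet, ncard_ovalSet]
  · exact Set.finite_of_ncard_ne_zero (by rw [ncard_ovalSet]; omega)

theorem modEq_of_equivalent_ovalSet {n d e : ℕ} (hn : Odd n) (hn5 : 5 ≤ n)
    (hF : Nat.card F = 2 ^ n) (hnd : Nat.gcd n d = 1) (hne : Nat.gcd n e = 1)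
    (heq : Equivalent symplecticMul (ovalSet F d) (ovalSet F e)) :
    (d : ℤ) ≡ e [ZMOD n] ∨ (d : ℤ) ≡ -e [ZMOD n] := by
  have h := isPresemifieldMul_symplecticMul hn hF
  obtain ⟨φ, ⟨ψ, hφ⟩, hO⟩ := heq
  have hφ : IsCollineationPair symplecticMul φ ψ := hφ
  obtain ⟨hψ, hinf⟩ := hφ.fixes_flag h (not_inverseAddClosed_symplecticMul hn hn5 hF)
    (not_inverseAddClosed_flip_symplecticMul hn hn5 hF)
  obtain ⟨B, v₀, κ, hB, hκ, hspread⟩ := hφ.exists_addMonoidHom h hψ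
  have hκn : κ none = none := by
    refine infinitePoint_injective ?_
    rw [← hκ]
    exact hinf
  have hκs : ∀ s, ∃ t, κ (some s) = some t := fun s => by
    rcases hs : κ (some s) with _ | t
    · cases κ.injective (hs.trans hκn.symm)
    · exact ⟨t, rfl⟩
  choose k hk using hκs
  -- In block form, `B (x, y) = (f x, g x + m y)`.
  let f : F → F := fun x => (B (x, 0)).1
  let g : F → F := fun x => (B (x, 0)).2
  let m : F → F := fun y => (B (0, y)).2
  have hBxy : ∀ x y, B (x, y) = (f x, g x + m y) := fun x y => by
    have h1 : (x, y) = (x, 0) + ((0, y) : F × F) := by simp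
    have h3 : (B (0, y)).1 = 0 := by
      have := (hspread none (0, y)).1 rfl
      rwa [hκn] at this
    rw [h1, map_add]
    refine Prod.ext ?_ rfl
    rw [Prod.fst_add, h3, add_zero]
  have hfadd : ∀ x y, f (x + y) = f x + f y := fun x y => by
    have h1 : ((x + y, 0) : F × F) = (x, 0) + (y, 0) := by simp
    change (B (x + y, 0)).1 = _
    rw [h1, map_add]
    rfl
  have hf0 : f 0 = 0 := by
    have := hfadd 0 0
    rw [add_zero] at this
    exact left_eq_add.1 this
  have hfinj : Function.Injective f := fun x y hxy => by
    have h1 : f (x + y) = 0 := by rw [hfadd, hxy, CharTwo.add_self_eq_zero]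
    have h3 : (x + y, (0 : F)) ∈ spread h none := by
      rw [hspread, hκn]
      exact h1
    exact (CharTwo.add_eq_zero).1 h3
  have hk' : ∀ s x, g x + m (symplecticMul x s) = symplecticMul (f x) (k s) := by
    intro s x
    have h1 := (hspread (some s) (x, symplecticMul x s)).1 rfl
    rw [hk, hBxy] at h1
    exact h1
  have hm0 : m 0 = 0 := by
    change (B ((0 : F), (0 : F))).2 = 0
    exact congrArg Prod.snd (map_zero B)
  -- The slopes `0` and `1` are preserved or interchanged.
  have hslope : ∀ s, (s = 0 ∨ s = 1) → (k s = 0 ∨ k s = 1) := by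
    intro s hs
    have h1 : φ (.slope s) ∈ ovalSet F e := by
      rw [← hO]
      refine ⟨_, Or.inr ?_, rfl⟩
      rcases hs with rfl | rfl
      · exact Or.inl rfl
      · exact Or.inr rfl
    have h3 : φ (.slope s) = .slope (k s) := by
      have := hκ (some s)
      rwa [hk] at this
    rw [h3] at h1
    rcases h1 with ⟨y, hy⟩ | hy | hy
    · cases hy
    · exact Or.inl (PlanePoint.slope.inj hy)
    · exact Or.inr (PlanePoint.slope.inj hy)
  have hk01 : k 0 ≠ k 1 := fun h0 => by
    have := κ.injective ((hk 0).trans ((congrArg some h0).trans (hk 1).symm))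
    exact zero_ne_one (Option.some_inj.1 this)
  -- The affine points of both sets are subgroups, hence the linear part maps one to the other.
  have hoval : ∀ y, f (y ^ 2 ^ d + y) = (g (y ^ 2 ^ d + y) + m y) ^ 2 ^ e +
      (g (y ^ 2 ^ d + y) + m y) := by
    have hpt : ∀ y : F, ∃ z, B (y ^ 2 ^ d + y, y) + v₀ = (z ^ 2 ^ e + z, z) := by
      intro y
      have h1 : φ (.affine (y ^ 2 ^ d + y) y) ∈ ovalSet F e := by
        rw [← hO]
        exact ⟨_, Or.inl ⟨y, rfl⟩, rfl⟩
      have h3 := hB (y ^ 2 ^ d + y, y)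
      simp only at h3
      rw [h3] at h1
      rcases h1 with ⟨z, hz⟩ | hz | hz
      · exact ⟨z, Prod.ext (PlanePoint.affine.inj hz).1 (PlanePoint.affine.inj hz).2⟩
      · cases hz
      · cases hz
    obtain ⟨w, hw⟩ := hpt 0
    rw [zero_pow (by positivity), add_zero, ← Prod.zero_eq_mk, map_zero, zero_add] at hw
    intro y
    obtain ⟨z, hz⟩ := hpt y
    rw [hw, hBxy] at hz
    have hz1 : f (y ^ 2 ^ d + y) + (w ^ 2 ^ e + w) = z ^ 2 ^ e + z := congrArg Prod.fst hz
    have hz2 : g (y ^ 2 ^ d + y) + m y + w = z := congrArg Prod.snd hz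
    rw [← hz2, two_pow_add] at hz1
    linear_combination hz1
  have hpre := hk' 0
  simp only [h.mul_zero, hm0, add_zero] at hpre
  have hpre1 := hk' 1
  simp only [symplecticMul_one] at hpre1
  have hmf : ∀ x, m x = f x := by
    intro x
    have h1 := hpre x
    have h3 := hpre1 x
    rcases hslope 0 (Or.inl rfl) with h0 | h0
    · have h4 : k 1 = 1 := (hslope 1 (Or.inr rfl)).resolve_left fun h5 => hk01 (h0.trans h5.symm)
      rw [h0, h.mul_zero] at h1
      rwa [h4, symplecticMul_one, h1, zero_add] at h3
    · have h4 : k 1 = 0 := (hslope 1 (Or.inr rfl)).resolve_right fun h5 => hk01 (h0.trans h5.symm)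
      rw [h0, symplecticMul_one] at h1
      rw [h4, h.mul_zero, h1] at h3
      exact ((CharTwo.add_eq_zero).1 h3).symm
  have hmul : ∀ x s, f (symplecticMul x s) = symplecticMul (f x) (k s - k 0) := by
    intro x s
    rw [h.mul_sub, ← hk' s, ← hpre, hmf, add_sub_cancel_left]
  rcases hslope 0 (Or.inl rfl) with h0 | h0
  · left
    refine modEq_of_autotopism hn hn5 hF hnd hne hfadd hfinj hmul fun y => ?_
    have h1 := hoval y
    rw [hpre, h0, h.mul_zero, zero_add, hmf, hfadd] at h1
    exact add_right_cancel h1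
  · right
    -- Here `f` conjugates `x ↦ x ^ 2 ^ d` to the inverse of `x ↦ x ^ 2 ^ e`, which is the power of
    -- exponent `2 ^ (e * (n - 1))`.
    have hee : e * (n - 1) + e = n * e := by
      rw [Nat.mul_sub, mul_one, Nat.sub_add_cancel (Nat.le_mul_of_pos_right e (by omega)), mul_comm]
    have h3 : (d : ℤ) ≡ (e * (n - 1) : ℕ) [ZMOD n] := by
      refine modEq_of_autotopism hn hn5 hF hnd ?_ hfadd hfinj hmul fun y => ?_
      · refine Nat.Coprime.mul_right hne ?_
        rw [Nat.coprime_self_sub_right (by omega)]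
        exact Nat.coprime_one_right n
      · have h1 := hoval y
        rw [hpre, h0, symplecticMul_one, hmf, hfadd, add_assoc, CharTwo.add_self_eq_zero,
          add_zero, add_comm] at h1
        rw [add_right_cancel h1, ← pow_mul, ← pow_add, add_comm, hee,
          pow_two_pow_mul_eq_self hF]
    refine h3.trans ?_
    rw [Int.modEq_iff_dvd]
    refine ⟨-e, ?_⟩
    have : ((e * (n - 1) : ℕ) : ℤ) + e = n * e := by exact_mod_cast hee
    linear_combination -this

end Symplectic

theorem mainTheorem2 {F : Type*} [Field F] [Finite F] [CharP F 2] (n d e : ℕ)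
    (hn : Odd n) (hF : Nat.card F = 2 ^ n) (hd : 0 < d) (he : 0 < e)
    (hnd : Nat.gcd n d = 1) (hne : Nat.gcd n e = 1) :
    SemifieldPlane.IsHyperoval symplecticMul (ovalSet F d) ∧
    SemifieldPlane.IsHyperoval symplecticMul (ovalSet F e) ∧
    (SemifieldPlane.Equivalent symplecticMul (ovalSet F d) (ovalSet F e) ↔
      ((d : ℤ) ≡ e [ZMOD n] ∨ (d : ℤ) ≡ -e [ZMOD n])) := by
  refine ⟨isHyperoval_ovalSet hn hF hnd, isHyperoval_ovalSet hn hF hne, fun h => ?_, ?_⟩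
  · by_cases hn5 : 5 ≤ n
    · exact modEq_of_equivalent_ovalSet hn hn5 hF hnd hne h
    · -- Modulo `1` and modulo `3` any two units agree up to sign.
      have h13 : n = 1 ∨ n = 3 := by
        obtain ⟨j, rfl⟩ := hn
        omega
      rcases h13 with rfl | rfl
      · left
        exact Int.modEq_one
      · have hd3 : ¬ 3 ∣ d := (Nat.Prime.coprime_iff_not_dvd Nat.prime_three).1 hnd
        have he3 : ¬ 3 ∣ e := (Nat.Prime.coprime_iff_not_dvd Nat.prime_three).1 hne
        simp only [Int.ModEq]
        omega
  · rintro (h | h)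
    · have heq : ovalSet F d = ovalSet F e := by
        simp only [ovalSet, pow_two_pow_eq_of_modEq hF h]
      rw [heq]
      exact ⟨Equiv.refl _, ⟨Equiv.refl _, fun _ _ => Iff.rfl⟩, Set.image_id _⟩
    · exact equivalent_ovalSet_of_modEq_neg hn hF h
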